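/- **Setting.** Let $\gamma:[0,1]\to\mathbb C$ be a simple loop that starts at the origin and returns to it, $\gamma(0)=\gamma(1)=0$, of finite length, injective on $[0,1)$, and $C^1$ with $\gamma'\neq0$ on $(0,1)$ (either orientation is allowed). We also write $\gamma$ for its image. For $z=\gamma(t)\in\gamma\setminus\{0\}$, $0<t<1$, let $F(z)_+$ and $F(z)_-$ denote the non-tangential limits of $F$ at $z$ from the left and from the right of the oriented curve. Let $W$ be an $N\times N$ regular matrix of weights of Bessel type on $\gamma$. *Bessel type* means that each entry is, on $\gamma\setminus\{0\}$, a finite sum of terms $\varphi(z)z^{p}\log^{q}(z)e^{-\lambda/z}$ with $p\in\mathbb C$, $q\in\mathbb N=\{0,1,\dots\}$, $\operatorname{Re}\lambda\ge0$ and $\varphi$ Hölder continuous, bounded and nonvanishing on $\gamma$; here $\log$ is a continuous branch along $\gamma\setminus\{0\}$ and $z^p=e^{p\log z}$. *Regular* means that $W$ is integrable along $\gamma$ and that the moments $W_n=\int_\gamma z^nW(z)\frac{dz}{2\pi i}$ satisfy $\det[W_{j+k}]_{j,k=0,\dots,n}\ne0$ for all $n\in\mathbb N$. Let $P_n^{L},P_n^{R}$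 be the monic matrix polynomials of degree $n$, and $C_n$ the nonsingular matrices, with $$\int_\gamma P_n^L(z)W(z)z^k\tfrac{dz}{2\pi i}=\delta_{n,k}C_n^{-1}=\int_\gamma z^kW(z)P_n^R(z)\tfrac{dz}{2\pi i}\qquad(0\le k\le n),$$ and put $Q_n^L(z)=\int_\gamma \frac{P_n^L(z')W(z')}{z'-z}\frac{dz'}{2\pi i}$, $Q_n^R(z)=\int_\gamma \frac{W(z')P_n^R(z')}{z'-z}\frac{dz'}{2\pi i}$, $$Y_n^L=\begin{bmatrix}P_n^L&Q_n^L\\-C_{n-1}P_{n-1}^L&-C_{n-1}Q_{n-1}^L\end{bmatrix},\qquad Y_n^R=\begin{bmatrix}P_n^R&-P_{n-1}^RC_{n-1}\\Q_n^R&-Q_{n-1}^RC_{n-1}\end{bmatrix},$$ where for $n=0$ the conventions $P_{-1}=0$, $Q_{-1}=-C_{-1}^{-1}$ are used, so that $Y_0^L=\begin{bmatrix}I&Q_0^L\\0&I\end{bmatrix}$ and $Y_0^R=\begin{bmatrix}I&0\\Q_0^R&I\end{bmatrix}$. Let $W_L,W_R$ be holomorphic invertible $N\times N$ matrix functions on $\mathbb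 C\setminus\gamma$ with $z^2W_L'=h^LW_L$ and $z^2W_R'=W_Rh^R$ there, for some entire matrix functions $h^L,h^R$, and such that $W=(W_LW_R)_+$ on $\gamma\setminus\{0\}$. Put $$Z_n^L=Y_n^L\begin{bmatrix}W_L&0\\0&W_R^{-1}\end{bmatrix},\qquad Z_n^R=\begin{bmatrix}W_R&0\\0&W_L^{-1}\end{bmatrix}Y_n^R .$$ **Theorem.** There are constant invertible matrices $C^L,C^R$ such that on $\gamma\setminus\{0\}$ the boundary values of $W_L$ and $W_R$ exist, $(W_L)_+$ and $(W_R)_+$ are invertible, and $$(W_L)_-=(W_L)_+\,C^L,\qquad (W_R)_-=C^R\,(W_R)_+ .$$ For every $n\in\mathbb N$: 1. $Z_n^L$ and $Z_n^R$ are holomorphic on $\mathbb C\setminus\gamma$; 2. at every point of $\gamma\setminus\{0\}$ the boundary values of $Z_n^L$ and $Z_n^R$ from both sides exist and satisfy the constant jump conditions $$(Z_n^L)_+=(Z_n^L)_-\begin{bmatrix}(C^L)^{-1}&(C^L)^{-1}\\0&C^R\end{bmatrix},\qquad (Z_n^R)_+=\begin{bmatrix}(C^R)^{-1}&0\\(C^R)^{-1}&C^L\end{bmatrix}(Z_n^R)_-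 .$$ -/

import Mathlib

open Set Filter Topology MeasureTheory
open scoped NNReal

/-- The trace (image) of a curve parametrised by `[0, 1]`. -/
def loopTrace (γ : ℝ → ℂ) : Set ℂ := γ '' Icc (0 : ℝ) 1

/-- A simple loop `γ : [0, 1] → ℂ` that starts at the origin and returns to it: closed, without
other self-intersections, of finite length, and continuously differentiable with nonvanishing
derivative away from its base point (where a corner or a cusp is allowed). -/
structure IsSimpleLoopAtZero (γ : ℝ → ℂ) : Prop where
  continuousOn : ContinuousOn γ (Icc (0 : ℝ) 1)
  start_eq : γ 0 = 0
  finish_eq : γ 1 = 0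
  injOn : InjOn γ (Ico (0 : ℝ) 1)
  differentiableAt : ∀ t ∈ Ioo (0 : ℝ) 1, DifferentiableAt ℝ γ t
  continuousOn_deriv : ContinuousOn (deriv γ) (Ioo (0 : ℝ) 1)
  deriv_ne_zero : ∀ t ∈ Ioo (0 : ℝ) 1, deriv γ t ≠ 0
  integrable_deriv : IntervalIntegrable (deriv γ) volume 0 1

/-- The matrix integral `∫_γ F(z) dz / (2πi)`, entry by entry. -/
noncomputable def loopIntegral {m n : Type*} (γ : ℝ → ℂ) (F : ℂ → Matrix m n ℂ) : Matrix m n ℂ :=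
  Matrix.of fun i j =>
    (2 * (Real.pi : ℂ) * Complex.I)⁻¹ * ∫ t in (0 : ℝ)..1, F (γ t) i j * deriv γ t

/-- `F` is a holomorphic matrix function on the (open) set `S`. -/
def MatrixHolomorphicOn {m n : Type*} (F : ℂ → Matrix m n ℂ) (S : Set ℂ) : Prop :=
  ∀ i j, DifferentiableOn ℂ (fun z => F z i j) S

/-- `A` is the boundary value `F(z)_+` of `F` at `z = γ t`: the non-tangential limit of `F` from the
left of the oriented curve, i.e. the limit along every sector
`κ |w - z| < Im ((w - z) / γ'(t))` about the left normal `i γ'(t)`. -/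
def HasPlusValue {m n : Type*} (γ : ℝ → ℂ) (F : ℂ → Matrix m n ℂ) (t : ℝ) (A : Matrix m n ℂ) :
    Prop :=
  ∀ κ : ℝ, 0 < κ →
    Tendsto F (𝓝[{w : ℂ | κ * ‖w - γ t‖ < ((w - γ t) / deriv γ t).im}] (γ t)) (𝓝 A)

/-- `A` is the boundary value `F(z)_-` of `F` at `z = γ t`: the non-tangential limit of `F` from the
right of the oriented curve. -/
def HasMinusValue {m n : Type*} (γ : ℝ → ℂ) (F : ℂ → Matrix m n ℂ) (t : ℝ) (A : Matrix m n ℂ) :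
    Prop :=
  ∀ κ : ℝ, 0 < κ →
    Tendsto F (𝓝[{w : ℂ | κ * ‖w - γ t‖ < -((w - γ t) / deriv γ t).im}] (γ t)) (𝓝 A)

/-- Matrix weights of Bessel type on `γ`: every entry is a finite sum of terms
`φ(z) z^p log^q(z) exp(-λ/z)` with `Re λ ≥ 0`, `q ∈ ℕ`, and `φ` Hölder continuous, bounded and
nonvanishing on `γ`. The function `ℓ` is a continuous branch of the logarithm along `γ ∖ {0}`. -/
def IsBesselType {N : ℕ} (γ : ℝ → ℂ) (W : ℂ → Matrix (Fin N) (Fin N) ℂ) : Prop :=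
  ∃ ℓ : ℂ → ℂ, ContinuousOn ℓ (loopTrace γ \ {0}) ∧
    (∀ z ∈ loopTrace γ \ {0}, Complex.exp (ℓ z) = z) ∧
    ∀ j k : Fin N, ∃ (M : ℕ) (φ : Fin M → ℂ → ℂ) (p : Fin M → ℂ) (q : Fin M → ℕ) (lam : Fin M → ℂ),
      (∀ m, 0 ≤ (lam m).re) ∧
      (∀ m, ∃ K r : ℝ≥0, 0 < r ∧ r ≤ 1 ∧ HolderOnWith K r (φ m) (loopTrace γ)) ∧
      (∀ m, ∃ B : ℝ, ∀ z ∈ loopTrace γ, ‖φ m z‖ ≤ B) ∧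
      (∀ m, ∀ z ∈ loopTrace γ, φ m z ≠ 0) ∧
      ∀ z ∈ loopTrace γ \ {0}, W z j k =
        ∑ m, φ m z * Complex.exp (p m * ℓ z) * ℓ z ^ q m * Complex.exp (-(lam m) / z)

/-- The moments `W_n = ∫_γ z^n W(z) dz / (2πi)`. -/
noncomputable def moment {N : ℕ} (γ : ℝ → ℂ) (W : ℂ → Matrix (Fin N) (Fin N) ℂ) (n : ℕ) :
    Matrix (Fin N) (Fin N) ℂ :=
  loopIntegral γ fun z => z ^ n • W z

/-- Regular matrices of weights: `W` is integrable along `γ` (hence all its moments exist) and all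
the block Hankel determinants `det [W_{j+k}]_{j,k=0..n}` are different from zero. -/
def IsRegularWeight {N : ℕ} (γ : ℝ → ℂ) (W : ℂ → Matrix (Fin N) (Fin N) ℂ) : Prop :=
  (∀ i j, IntervalIntegrable (fun t => W (γ t) i j * deriv γ t) volume 0 1) ∧
  ∀ n : ℕ, (Matrix.of fun a b : Fin (n + 1) × Fin N =>
    moment γ W ((a.1 : ℕ) + (b.1 : ℕ)) a.2 b.2).det ≠ 0

/-- `P` is a monic matrix polynomial of degree `n`. -/
def IsMonicMatrixPoly {N : ℕ} (n : ℕ) (P : ℂ → Matrix (Fin N) (Fin N) ℂ) : Prop :=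
  ∃ c : ℕ → Matrix (Fin N) (Fin N) ℂ,
    ∀ z, P z = z ^ n • (1 : Matrix (Fin N) (Fin N) ℂ) + ∑ k ∈ Finset.range n, z ^ k • c k

/-- `PL n` and `PR n` are the monic left- and right-orthogonal matrix polynomials of degree `n` for
the weight `W`, with nonsingular normalising matrices `C n`. -/
structure AreOrthogonalPolys {N : ℕ} (γ : ℝ → ℂ) (W : ℂ → Matrix (Fin N) (Fin N) ℂ)
    (PL PR : ℕ → ℂ → Matrix (Fin N) (Fin N) ℂ) (C : ℕ → Matrix (Fin N) (Fin N) ℂ) : Prop where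
  monic_left : ∀ n, IsMonicMatrixPoly n (PL n)
  monic_right : ∀ n, IsMonicMatrixPoly n (PR n)
  nonsingular : ∀ n, IsUnit (C n).det
  orthogonal_left : ∀ n k, k ≤ n →
    loopIntegral γ (fun z => z ^ k • (PL n z * W z)) = if k = n then (C n)⁻¹ else 0
  orthogonal_right : ∀ n k, k ≤ n →
    loopIntegral γ (fun z => z ^ k • (W z * PR n z)) = if k = n then (C n)⁻¹ else 0

/-- The left second kind function `∫_γ P(z') W(z') / (z' - z) dz' / (2πi)`. -/
noncomputable def secondKindL {N : ℕ} (γ : ℝ → ℂ) (W P : ℂ → Matrix (Fin N) (Fin N) ℂ) (z : ℂ) :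
    Matrix (Fin N) (Fin N) ℂ :=
  loopIntegral γ fun w => (w - z)⁻¹ • (P w * W w)

/-- The right second kind function `∫_γ W(z') P(z') / (z' - z) dz' / (2πi)`. -/
noncomputable def secondKindR {N : ℕ} (γ : ℝ → ℂ) (W P : ℂ → Matrix (Fin N) (Fin N) ℂ) (z : ℂ) :
    Matrix (Fin N) (Fin N) ℂ :=
  loopIntegral γ fun w => (w - z)⁻¹ • (W w * P w)

/-- The matrix `Y_n^L`. For `n = 0` the conventions `P_{-1} = 0` and `Q_{-1} = -C_{-1}^{-1}` make
the second block row equal to `[0, I]`. -/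
noncomputable def YL {N : ℕ} (γ : ℝ → ℂ) (W : ℂ → Matrix (Fin N) (Fin N) ℂ)
    (PL : ℕ → ℂ → Matrix (Fin N) (Fin N) ℂ) (C : ℕ → Matrix (Fin N) (Fin N) ℂ) :
    ℕ → ℂ → Matrix (Fin N ⊕ Fin N) (Fin N ⊕ Fin N) ℂ
  | 0, z => Matrix.fromBlocks (PL 0 z) (secondKindL γ W (PL 0) z) 0 1
  | n + 1, z => Matrix.fromBlocks (PL (n + 1) z) (secondKindL γ W (PL (n + 1)) z)
      (-(C n * PL n z)) (-(C n * secondKindL γ W (PL n) z))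

/-- The matrix `Y_n^R`. For `n = 0` the conventions `P_{-1} = 0` and `Q_{-1} = -C_{-1}^{-1}` make
the second block column equal to `[0, I]`. -/
noncomputable def YR {N : ℕ} (γ : ℝ → ℂ) (W : ℂ → Matrix (Fin N) (Fin N) ℂ)
    (PR : ℕ → ℂ → Matrix (Fin N) (Fin N) ℂ) (C : ℕ → Matrix (Fin N) (Fin N) ℂ) :
    ℕ → ℂ → Matrix (Fin N ⊕ Fin N) (Fin N ⊕ Fin N) ℂ
  | 0, z => Matrix.fromBlocks (PR 0 z) 0 (secondKindR γ W (PR 0) z) 1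
  | n + 1, z => Matrix.fromBlocks (PR (n + 1) z) (-(PR n z * C n))
      (secondKindR γ W (PR (n + 1)) z) (-(secondKindR γ W (PR n) z * C n))

/-- `Z_n^L = Y_n^L diag(W_L, W_R⁻¹)`. -/
noncomputable def ZL {N : ℕ} (γ : ℝ → ℂ) (W WL WR : ℂ → Matrix (Fin N) (Fin N) ℂ)
    (PL : ℕ → ℂ → Matrix (Fin N) (Fin N) ℂ) (C : ℕ → Matrix (Fin N) (Fin N) ℂ) (n : ℕ) (z : ℂ) :
    Matrix (Fin N ⊕ Fin N) (Fin N ⊕ Fin N) ℂ :=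
  YL γ W PL C n z * Matrix.fromBlocks (WL z) 0 0 (WR z)⁻¹

/-- `Z_n^R = diag(W_R, W_L⁻¹) Y_n^R`. -/
noncomputable def ZR {N : ℕ} (γ : ℝ → ℂ) (W WL WR : ℂ → Matrix (Fin N) (Fin N) ℂ)
    (PR : ℕ → ℂ → Matrix (Fin N) (Fin N) ℂ) (C : ℕ → Matrix (Fin N) (Fin N) ℂ) (n : ℕ) (z : ℂ) :
    Matrix (Fin N ⊕ Fin N) (Fin N ⊕ Fin N) ℂ :=
  Matrix.fromBlocks (WR z) 0 0 (WL z)⁻¹ * YR γ W PR C n z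

/-- `W = W_L W_R` is a factorisation through Pearson equations of Bessel type: `W_L` and `W_R` are
holomorphic and invertible off `γ`, satisfy there `z² W_L' = h_L W_L` and `z² W_R' = W_R h_R` with
entire `h_L`, `h_R`, and the weight on `γ ∖ {0}` is the boundary value `(W_L W_R)_+`. -/
structure IsPearsonFactorization {N : ℕ} (γ : ℝ → ℂ)
    (W WL WR hL hR : ℂ → Matrix (Fin N) (Fin N) ℂ) : Prop where
  entire_left : MatrixHolomorphicOn hL univ
  entire_right : MatrixHolomorphicOn hR univ
  holomorphic_left : MatrixHolomorphicOn WL (loopTrace γ)ᶜ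
  holomorphic_right : MatrixHolomorphicOn WR (loopTrace γ)ᶜ
  invertible_left : ∀ z ∉ loopTrace γ, IsUnit (WL z).det
  invertible_right : ∀ z ∉ loopTrace γ, IsUnit (WR z).det
  pearson_left : ∀ z ∉ loopTrace γ, ∀ i j,
    z ^ 2 * deriv (fun w => WL w i j) z = (hL z * WL z) i j
  pearson_right : ∀ z ∉ loopTrace γ, ∀ i j,
    z ^ 2 * deriv (fun w => WR w i j) z = (WR z * hR z) i j
  factor : ∀ t ∈ Ioo (0 : ℝ) 1, HasPlusValue γ (fun z => WL z * WR z) t (W (γ t))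

/-! Away from the origin the Pearson equations are regular linear equations. Near `z₀ ≠ 0` there is
a holomorphic invertible `Ψ` with `z² Ψ' = -h_R Ψ`, and then `(W_R Ψ)' = 0` off the loop. Close to a
point of the loop each side behaves like one connected piece, so `W_R = K_± Ψ⁻¹` there with constant
invertible `K_±`. Hence the boundary values exist, are invertible, and differ by the constant left
factor `K_- K_+⁻¹`; transposition gives the statement for `W_L`. The limits determine the factors,
and `(0, 1)` is connected, so the local constants agree along the whole loop (`exists_local_jump`,
`exists_constant_jump`).

The same local form shows that `W = (W_L W_R)_+` is, on a short arc, the restriction of a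
holomorphic function. For such a density the Plemelj formula is elementary (`cauchyIntegral_jump`).
Write the density on the arc as `(g(w) - g(z)) + g(z)`: the first part contributes an integral of
bounded difference quotients, with the same limit from both sides, and the second contributes `g(z)
∫ dw / (w - z)`, a difference of logarithms whose two one-sided limits differ by `2πi`. Thus the
second kind functions jump by `P W` or `W P`.

Finally, `(Q + P L R) R⁻¹ = P L + Q R⁻¹`: after multiplication by the factors of `W` the additive
jump becomes a constant triangular matrix (`left_block_jump`, `right_block_jump`). -/

/-! ### Filters of non-tangential approach and locally constant functions. -/

/-- The sector of aperture `κ` at `γ t` about the left (`σ = 1`) or right (`σ = -1`) normal. -/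
def sideSector (γ : ℝ → ℂ) (σ t κ : ℝ) : Set ℂ :=
  {w | κ * ‖w - γ t‖ < σ * ((w - γ t) / deriv γ t).im}

/-- The filter of non-tangential approach to `γ t` from the side `σ`. -/
noncomputable def sideFilter (γ : ℝ → ℂ) (σ t : ℝ) : Filter ℂ :=
  ⨆ (κ : ℝ) (_ : 0 < κ), 𝓝[sideSector γ σ t κ] (γ t)

theorem sideFilter_le_nhds (γ : ℝ → ℂ) (σ t : ℝ) : sideFilter γ σ t ≤ 𝓝 (γ t) :=
  iSup₂_le fun _ _ => nhdsWithin_le_nhds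

theorem hasPlusValue_iff {m n : Type*} {γ : ℝ → ℂ} {F : ℂ → Matrix m n ℂ} {t : ℝ}
    {A : Matrix m n ℂ} : HasPlusValue γ F t A ↔ Tendsto F (sideFilter γ 1 t) (𝓝 A) := by
  simp [HasPlusValue, sideFilter, sideSector, tendsto_iSup]

theorem hasMinusValue_iff {m n : Type*} {γ : ℝ → ℂ} {F : ℂ → Matrix m n ℂ} {t : ℝ}
    {A : Matrix m n ℂ} : HasMinusValue γ F t A ↔ Tendsto F (sideFilter γ (-1) t) (𝓝 A) := by
  simp [HasMinusValue, sideFilter, sideSector, tendsto_iSup]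

theorem eventually_sideFilter {γ : ℝ → ℂ} {σ t : ℝ} {p : ℂ → Prop} :
    (∀ᶠ w in sideFilter γ σ t, p w) ↔
      ∀ κ > 0, ∀ᶠ w in 𝓝[sideSector γ σ t κ] (γ t), p w := by
  simp [sideFilter, eventually_iSup]

theorem sideSector_anti {γ : ℝ → ℂ} {σ t κ κ' : ℝ} (h : κ ≤ κ') :
    sideSector γ σ t κ' ⊆ sideSector γ σ t κ := fun _ (hw : _ < _) =>
  show _ < _ from lt_of_le_of_lt (mul_le_mul_of_nonneg_right h (norm_nonneg _)) hw

theorem convex_sideSector {γ : ℝ → ℂ} {σ t κ : ℝ} (hκ : 0 ≤ κ) :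
    Convex ℝ (sideSector γ σ t κ) := by
  intro x hx y hy a b ha hb hab
  simp only [sideSector, mem_ofPred_eq] at *
  have e : a • x + b • y - γ t = (a : ℂ) * (x - γ t) + (b : ℂ) * (y - γ t) := by
    have : (a : ℂ) + b = 1 := by exact_mod_cast hab
    simp only [Complex.real_smul]
    linear_combination γ t * this
  have e2 : ((a • x + b • y - γ t) / deriv γ t).im =
      a * ((x - γ t) / deriv γ t).im + b * ((y - γ t) / deriv γ t).im := by
    rw [e, add_div, mul_div_assoc, mul_div_assoc, Complex.add_im, Complex.im_ofReal_mul,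
      Complex.im_ofReal_mul]
  have e3 : ‖a • x + b • y - γ t‖ ≤ a * ‖x - γ t‖ + b * ‖y - γ t‖ := by
    rw [e]
    refine (norm_add_le _ _).trans ?_
    rw [norm_mul, norm_mul, Complex.norm_real, Complex.norm_real, Real.norm_of_nonneg ha,
      Real.norm_of_nonneg hb]
  have e4 : κ * ‖a • x + b • y - γ t‖ ≤ κ * (a * ‖x - γ t‖ + b * ‖y - γ t‖) := by gcongr
  rw [e2]
  rcases ha.eq_or_lt with rfl | ha'
  · have : b = 1 := by linarith
    subst this
    linarith
  · have h1 := mul_lt_mul_of_pos_left hx ha'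
    have h2 := mul_le_mul_of_nonneg_left hy.le hb
    linarith

theorem sq_eq_one_of_sign {σ : ℝ} (hσ : σ = 1 ∨ σ = -1) : σ * σ = 1 := by
  rcases hσ with rfl | rfl <;> norm_num

theorem IsPreconnected.exists_eq_of_eventually_eq {α X : Type*} [TopologicalSpace α] {S : Set α}
    (hS : IsPreconnected S) {F : α → X} (hF : ∀ z ∈ S, ∀ᶠ w in 𝓝 z, F w = F z) {x y : α}
    (hx : x ∈ S) (hy : y ∈ S) : F x = F y := by
  -- For the discrete topology on the target, local constancy is continuity.
  let _ : TopologicalSpace X := ⊥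
  have : DiscreteTopology X := ⟨rfl⟩
  refine hS.constant (f := F) (fun z hz => ?_) hx hy
  have h : Tendsto F (𝓝 z) (𝓝 (F z)) :=
    tendsto_const_nhds.congr' ((hF z hz).mono fun w hw => hw.symm)
  exact h.mono_left nhdsWithin_le_nhds

/-! ### Local geometry of the loop at a smooth point. -/

namespace IsSimpleLoopAtZero

variable {γ : ℝ → ℂ}

theorem eq_of_eq (hγ : IsSimpleLoopAtZero γ) {t₀ s : ℝ} (ht₀ : t₀ ∈ Ioo (0 : ℝ) 1)
    (hs : s ∈ Icc (0 : ℝ) 1) (h : γ s = γ t₀) : s = t₀ := by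
  rcases hs.2.eq_or_lt with rfl | hs1
  · have : (0 : ℝ) = t₀ := hγ.injOn ⟨le_rfl, one_pos⟩ ⟨ht₀.1.le, ht₀.2⟩
      (by rw [← h, hγ.start_eq, hγ.finish_eq])
    exact absurd this ht₀.1.ne
  · exact hγ.injOn ⟨hs.1, hs1⟩ ⟨ht₀.1.le, ht₀.2⟩ h

theorem ne_zero (hγ : IsSimpleLoopAtZero γ) {t₀ : ℝ} (ht₀ : t₀ ∈ Ioo (0 : ℝ) 1) : γ t₀ ≠ 0 :=
  fun h => ht₀.1.ne (hγ.eq_of_eq ht₀ ⟨le_rfl, zero_le_one⟩ (hγ.start_eq.trans h.symm))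

/-- The part of the loop with parameter at distance at least `δ` from `t₀` is compact and misses `γ
t₀`, by injectivity. So points of the trace near `γ t₀` come from parameters near `t₀`. -/
theorem exists_separation (hγ : IsSimpleLoopAtZero γ) {t₀ δ : ℝ} (ht₀ : t₀ ∈ Ioo (0 : ℝ) 1)
    (hδ : 0 < δ) : ∃ η > 0, ∀ s ∈ Icc (0 : ℝ) 1, ‖γ s - γ t₀‖ < η → |s - t₀| < δ := by
  have hK : IsCompact (γ '' (Icc (0 : ℝ) 1 \ Ioo (t₀ - δ) (t₀ + δ))) :=
    (isCompact_Icc.diff isOpen_Ioo).image_of_continuousOn (hγ.continuousOn.mono sdiff_subset)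
  have hz : γ t₀ ∈ (γ '' (Icc (0 : ℝ) 1 \ Ioo (t₀ - δ) (t₀ + δ)))ᶜ := by
    rintro ⟨s, ⟨hs, hs'⟩, h⟩
    rw [hγ.eq_of_eq ht₀ hs h] at hs'
    exact hs' ⟨by linarith, by linarith⟩
  obtain ⟨η, hη, h⟩ := Metric.isOpen_iff.1 hK.isClosed.isOpen_compl _ hz
  refine ⟨η, hη, fun s hs hsη => ?_⟩
  by_contra hc
  refine h (mem_ball_iff_norm.2 hsη) ⟨s, ⟨hs, fun hs' => hc ?_⟩, rfl⟩
  rw [abs_lt]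
  constructor <;> linarith [hs'.1, hs'.2]

theorem isOpen_compl_trace (hγ : IsSimpleLoopAtZero γ) : IsOpen (loopTrace γ)ᶜ :=
  (isCompact_Icc.image_of_continuousOn hγ.continuousOn).isClosed.isOpen_compl

/-- Continuity of `γ'` at `t₀` and the mean value inequality for `γ x / γ'(t₀) - x`. After division
by `γ'(t₀)` the arc is a Lipschitz graph over the real axis: chords are dominated by their real
part. -/
theorem exists_chord_estimate (hγ : IsSimpleLoopAtZero γ) {t₀ : ℝ} (ht₀ : t₀ ∈ Ioo (0 : ℝ) 1) :
    ∃ δ > 0, Ioo (t₀ - δ) (t₀ + δ) ⊆ Ioo 0 1 ∧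
      (∀ t ∈ Ioo (t₀ - δ) (t₀ + δ), ‖deriv γ t / deriv γ t₀ - 1‖ ≤ 1 / 4) ∧
      ∀ s ∈ Ioo (t₀ - δ) (t₀ + δ), ∀ t ∈ Ioo (t₀ - δ) (t₀ + δ),
        ‖(γ s - γ t) / deriv γ t₀ - ((s - t : ℝ) : ℂ)‖ ≤ 1 / 4 * |s - t| := by
  have hc := hγ.deriv_ne_zero t₀ ht₀
  have hcont : ContinuousAt (fun t => deriv γ t / deriv γ t₀ - 1) t₀ :=
    ((hγ.continuousOn_deriv.continuousAt (isOpen_Ioo.mem_nhds ht₀)).div_const _).sub_const _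
  have h1 : ∀ᶠ t in 𝓝 t₀, ‖deriv γ t / deriv γ t₀ - 1‖ < 1 / 4 := by
    have : Tendsto (fun t => ‖deriv γ t / deriv γ t₀ - 1‖) (𝓝 t₀) (𝓝 0) := by
      simpa [div_self hc] using hcont.norm.tendsto
    exact this.eventually (gt_mem_nhds (by norm_num))
  obtain ⟨δ, hδ, h⟩ := Metric.eventually_nhds_iff_ball.1 (h1.and (isOpen_Ioo.mem_nhds ht₀))
  rw [Real.ball_eq_Ioo] at h
  refine ⟨δ, hδ, fun t ht => (h t ht).2, fun t ht => (h t ht).1.le, fun s hs t ht => ?_⟩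
  have hd : ∀ x ∈ Ioo (t₀ - δ) (t₀ + δ), HasDerivAt (fun x : ℝ => γ x / deriv γ t₀ - (x : ℂ))
      (deriv γ x / deriv γ t₀ - 1) x := fun x hx =>
    ((hγ.differentiableAt x (h x hx).2).hasDerivAt.div_const _).sub
      (HasDerivAt.ofReal_comp (hasDerivAt_id x))
  have := (convex_Ioo (t₀ - δ) (t₀ + δ)).norm_image_sub_le_of_norm_hasDerivWithin_le
    (fun x hx => (hd x hx).hasDerivWithinAt) (fun x hx => (h x hx).1.le) ht hs
  rw [Real.norm_eq_abs] at this
  have e : (γ s - γ t) / deriv γ t₀ - ((s - t : ℝ) : ℂ) =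
      γ s / deriv γ t₀ - (s : ℂ) - (γ t / deriv γ t₀ - (t : ℂ)) := by
    push_cast
    ring
  rwa [e]

/-- Short chords at `γ t` are almost tangent, so the trace eventually leaves every non-tangential
sector. -/
theorem exists_abs_im_chord_le (hγ : IsSimpleLoopAtZero γ) {t : ℝ}
    (ht : t ∈ Ioo (0 : ℝ) 1) {κ : ℝ} (hκ : 0 < κ) :
    ∃ ρ > 0, ∀ s ∈ Icc (0 : ℝ) 1, ‖γ s - γ t‖ < ρ →
      |((γ s - γ t) / deriv γ t).im| ≤ κ * ‖γ s - γ t‖ := by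
  obtain ⟨δ, hδ, hsub, -, hch⟩ := hγ.exists_chord_estimate ht
  have hc := hγ.deriv_ne_zero t ht
  have hc' : 0 < ‖deriv γ t‖ := norm_pos_iff.2 hc
  have hd := (hγ.differentiableAt t ht).hasDerivAt
  -- One factor `‖γ'(t)‖` pays for the division by `γ'(t)`; the other, with `3 / 4`, comes from the
  -- lower bound `3 / 4 * |s - t| * ‖γ'(t)‖` for the chord.
  have hlit := hd.isLittleO.def (c := κ * (3 / 4) * ‖deriv γ t‖ * ‖deriv γ t‖) (by positivity)
  obtain ⟨δ', hδ', hb⟩ := Metric.eventually_nhds_iff.1 hlit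
  obtain ⟨ρ, hρ, hsep⟩ := hγ.exists_separation ht (lt_min hδ hδ')
  refine ⟨ρ, hρ, fun s hs hsρ => ?_⟩
  have hst := hsep s hs hsρ
  have h1 := hch s (by have := abs_lt.1 (hst.trans_le (min_le_left _ _)); constructor <;> linarith)
    t ⟨by linarith, by linarith⟩
  have h2 := hb (y := s) (by rw [Real.dist_eq]; exact hst.trans_le (min_le_right _ _))
  rw [Real.norm_eq_abs] at h2
  have h3 : 3 / 4 * |s - t| ≤ ‖(γ s - γ t) / deriv γ t‖ := by
    have := norm_sub_norm_le (((s - t : ℝ) : ℂ)) ((γ s - γ t) / deriv γ t)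
    rw [norm_sub_rev, Complex.norm_real, Real.norm_eq_abs] at this
    linarith
  -- The tangential part becomes the real number `s - t` after the division and does not affect the
  -- imaginary part.
  have h4 : ((γ s - γ t) / deriv γ t).im =
      ((γ s - γ t - (s - t) • deriv γ t) / deriv γ t).im := by
    rw [sub_div (γ s - γ t), Complex.sub_im ((γ s - γ t) / deriv γ t), Complex.real_smul,
      mul_div_assoc, div_self hc, mul_one,
      Complex.ofReal_im, sub_zero]
  rw [norm_div, le_div_iff₀ hc'] at h3
  rw [h4]
  refine (Complex.abs_im_le_norm _).trans ?_
  rw [norm_div, div_le_iff₀ hc']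
  calc _ ≤ _ := h2
    _ = κ * (3 / 4 * |s - t| * ‖deriv γ t‖) * ‖deriv γ t‖ := by ring
    _ ≤ _ := by gcongr

theorem exists_truncated_sector (hγ : IsSimpleLoopAtZero γ) {t σ : ℝ} (hσ : σ = 1 ∨ σ = -1)
    (ht : t ∈ Ioo (0 : ℝ) 1) {κ : ℝ} (hκ : 0 < κ) :
    ∃ ρ > 0, Disjoint (sideSector γ σ t κ ∩ Metric.ball (γ t) ρ) (loopTrace γ) := by
  obtain ⟨ρ, hρ, h⟩ := hγ.exists_abs_im_chord_le ht hκ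
  refine ⟨ρ, hρ, Set.disjoint_left.2 ?_⟩
  rintro _ ⟨hw, hwρ⟩ ⟨s, hs, rfl⟩
  have h1 := h s hs (mem_ball_iff_norm.1 hwρ)
  simp only [sideSector, mem_ofPred_eq] at hw
  have h2 := abs_le.1 h1
  rcases hσ with rfl | rfl <;> linarith

theorem eventually_notMem_trace (hγ : IsSimpleLoopAtZero γ) {t σ : ℝ} (hσ : σ = 1 ∨ σ = -1)
    (ht : t ∈ Ioo (0 : ℝ) 1) : ∀ᶠ w in sideFilter γ σ t, w ∉ loopTrace γ := by
  refine eventually_sideFilter.2 fun κ hκ => ?_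
  obtain ⟨ρ, hρ, h⟩ := hγ.exists_truncated_sector hσ ht hκ
  filter_upwards [self_mem_nhdsWithin, nhdsWithin_le_nhds (Metric.ball_mem_nhds _ hρ)] with w h1 h2
  exact Set.disjoint_left.1 h ⟨h1, h2⟩

end IsSimpleLoopAtZero

/-! ### Each side of the loop is locally connected to itself. -/

/-- A direction close to the normal stays in the non-tangential sectors of moderate aperture. -/
theorem mem_sideSector_of_ray {γ : ℝ → ℂ} {t σ : ℝ} (hσ : σ = 1 ∨ σ = -1) {c : ℂ} (hc : c ≠ 0)
    (h : ‖deriv γ t / c - 1‖ ≤ 1 / 4) {κ : ℝ} (hκ : κ * ‖c‖ ≤ 1 / 4) {ε : ℝ} (hε : 0 < ε) :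
    γ t + ε * (σ * Complex.I * c) ∈ sideSector γ σ t κ := by
  have hσ2 := sq_eq_one_of_sign hσ
  simp only [sideSector, mem_ofPred_eq, add_sub_cancel_left]
  set e := deriv γ t / c with he
  have hre : 3 / 4 ≤ e.re := by
    have := (abs_le.1 ((Complex.abs_re_le_norm _).trans h)).1
    simp at this
    linarith
  have hn : ‖e‖ ≤ 5 / 4 := by
    have := norm_add_le (e - 1) 1
    simp at this
    linarith
  have hn0 : 0 < ‖e‖ := lt_of_lt_of_le (by norm_num) (hre.trans (Complex.re_le_norm e))
  have hdc : deriv γ t = e * c := by rw [he, div_mul_cancel₀ _ hc]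
  have e1 : ε * (σ * Complex.I * c) / deriv γ t = ((ε * σ : ℝ) : ℂ) * (Complex.I * e⁻¹) := by
    have : e ≠ 0 := norm_pos_iff.1 hn0
    rw [hdc]
    push_cast
    field_simp
  have e2 : ‖(ε : ℂ) * (σ * Complex.I * c)‖ = ε * ‖c‖ := by
    have : |σ| = 1 := by rcases hσ with rfl | rfl <;> norm_num
    simp [this, abs_of_pos hε]
  rw [e1, e2, Complex.im_ofReal_mul, Complex.I_mul_im, Complex.inv_re, Complex.normSq_eq_norm_sq]
  -- This is `(3/4) / (5/4)²`, a lower bound for `Re (1/e)`; it exceeds the `1/4` allowed for `κ *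
  -- ‖c‖`.
  have e3 : 12 / 25 ≤ e.re / ‖e‖ ^ 2 := by
    rw [le_div_iff₀ (by positivity)]
    nlinarith
  calc κ * (ε * ‖c‖) = ε * (κ * ‖c‖) := by ring
    _ ≤ ε * (1 / 4) := by gcongr
    _ < ε * (e.re / ‖e‖ ^ 2) := mul_lt_mul_of_pos_left (by linarith) hε
    _ = σ * σ * ε * (e.re / ‖e‖ ^ 2) := by rw [hσ2, one_mul]
    _ = σ * (ε * σ * (e.re / ‖e‖ ^ 2)) := by ring

/-- The direction is built from a fixed `c` near `γ'(t)` instead of the exact normal, so that one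
family of parallel rays serves all points of an arc. -/
theorem tendsto_ray {γ : ℝ → ℂ} {t σ : ℝ} (hσ : σ = 1 ∨ σ = -1) {c : ℂ} (hc : c ≠ 0)
    (h : ‖deriv γ t / c - 1‖ ≤ 1 / 4) {κ : ℝ} (hκ : κ * ‖c‖ ≤ 1 / 4) :
    Tendsto (fun ε : ℝ => γ t + ε * (σ * Complex.I * c)) (𝓝[>] 0)
      (𝓝[sideSector γ σ t κ] (γ t)) := by
  refine tendsto_nhdsWithin_iff.2 ⟨?_, ?_⟩
  · have : Continuous fun ε : ℝ => γ t + ε * (σ * Complex.I * c) := by fun_prop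
    simpa using (this.tendsto 0).mono_left nhdsWithin_le_nhds
  · filter_upwards [self_mem_nhdsWithin] with ε hε
    exact mem_sideSector_of_ray hσ hc h hκ hε

theorem tendsto_normal_ray {γ : ℝ → ℂ} {t σ : ℝ} (hσ : σ = 1 ∨ σ = -1) (hc : deriv γ t ≠ 0) :
    Tendsto (fun ε : ℝ => γ t + ε * (σ * Complex.I * deriv γ t)) (𝓝[>] 0) (sideFilter γ σ t) := by
  have hn : 0 < ‖deriv γ t‖ := norm_pos_iff.2 hc
  have : (0 : ℝ) < 1 / (4 * ‖deriv γ t‖) := by positivity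
  refine (tendsto_ray hσ hc (by simp [div_self hc]) (κ := 1 / (4 * ‖deriv γ t‖)) ?_).mono_right
    (le_iSup₂_of_le _ this le_rfl)
  field_simp
  rfl

theorem sideFilter_neBot {γ : ℝ → ℂ} {t σ : ℝ} (hσ : σ = 1 ∨ σ = -1) (hc : deriv γ t ≠ 0) :
    (sideFilter γ σ t).NeBot :=
  (tendsto_normal_ray hσ hc).neBot

/-- Near a point of the loop other than the base point, a function which is locally constant off the
loop is constant on each side of it. -/
theorem IsSimpleLoopAtZero.exists_side_const {γ : ℝ → ℂ} (hγ : IsSimpleLoopAtZero γ) {X : Type*}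
    {t₀ σ : ℝ} (hσ : σ = 1 ∨ σ = -1) (ht₀ : t₀ ∈ Ioo (0 : ℝ) 1) {r : ℝ} (hr : 0 < r) :
    ∃ δ > 0, Ioo (t₀ - δ) (t₀ + δ) ⊆ Ioo 0 1 ∧ ∀ F : ℂ → X,
      (∀ z ∈ Metric.ball (γ t₀) r \ loopTrace γ, ∀ᶠ w in 𝓝 z, F w = F z) →
      ∃ a, ∀ t ∈ Ioo (t₀ - δ) (t₀ + δ), ∀ᶠ w in sideFilter γ σ t, F w = a := by
  have hσ2 := sq_eq_one_of_sign hσ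
  obtain ⟨δ₁, hδ₁, hsub, hder, hch⟩ := hγ.exists_chord_estimate ht₀
  obtain ⟨η, hη, hsep⟩ := hγ.exists_separation ht₀ hδ₁
  have hc := hγ.deriv_ne_zero t₀ ht₀
  set c := deriv γ t₀ with hcdef
  have hcn : 0 < ‖c‖ := norm_pos_iff.2 hc
  have hcont := (hγ.differentiableAt t₀ ht₀).continuousAt
  -- Half of the radius is spent along the arc, half on the displacement off it.
  obtain ⟨δ₂, hδ₂, hb⟩ := Metric.continuousAt_iff.1 hcont (min r η / 2) (by positivity)
  set δ := min δ₁ δ₂ with hδdef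
  have hδ : 0 < δ := lt_min hδ₁ hδ₂
  have hδsub : Ioo (t₀ - δ) (t₀ + δ) ⊆ Ioo (t₀ - δ₁) (t₀ + δ₁) :=
    Ioo_subset_Ioo (by linarith [min_le_left δ₁ δ₂]) (by linarith [min_le_left δ₁ δ₂])
  have hnear : ∀ t ∈ Ioo (t₀ - δ) (t₀ + δ), γ t ∈ Metric.ball (γ t₀) (min r η / 2) := by
    intro t ht
    refine hb ?_
    rw [Real.dist_eq, abs_lt]
    constructor <;> linarith [ht.1, ht.2, min_le_right δ₁ δ₂]
  -- Translates of the arc in the single direction `σ i c` sweep out a connected strip on the side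
  -- `σ`.
  set f : ℝ × ℝ → ℂ := fun p => γ p.1 + p.2 * (σ * Complex.I * c) with hf
  set ε₀ := min r η / 2 / ‖c‖ with hε₀def
  have hε₀ : 0 < ε₀ := by positivity
  set B := Ioo (t₀ - δ) (t₀ + δ) ×ˢ Ioo 0 ε₀ with hB
  have hσn : |σ| = 1 := by rcases hσ with rfl | rfl <;> norm_num
  have hfball : ∀ p ∈ B, f p ∈ Metric.ball (γ t₀) (min r η) := by
    rintro ⟨s, ε⟩ ⟨hs, hε⟩
    have h1 := mem_ball_iff_norm.1 (hnear s hs)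
    rw [mem_ball_iff_norm]
    have h2 : ‖(ε : ℂ) * (σ * Complex.I * c)‖ < min r η / 2 := by
      have := (lt_div_iff₀ hcn).1 hε.2
      simpa [hσn, abs_of_pos hε.1] using this
    calc _ = ‖(γ s - γ t₀) + (ε : ℂ) * (σ * Complex.I * c)‖ := by
          congr 1
          simp only [hf]
          ring
      _ ≤ _ := norm_add_le _ _
      _ < _ := by linarith
  -- If a displaced point is `γ t`, then `(γ t - γ s) / c` is the purely imaginary number `i ε σ`.
  -- The chord estimate forces `t = s` through the real part, and then `ε = 0`.
  have hfavoid : ∀ p ∈ B, f p ∉ loopTrace γ := by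
    rintro ⟨s, ε⟩ hp ⟨t, ht, hte⟩
    have hε := hp.2
    have hs := hδsub hp.1
    have ht1 := hsep t ht (by
      rw [hte]
      exact (mem_ball_iff_norm.1 (hfball _ hp)).trans_le (min_le_right _ _))
    have ht2 : t ∈ Ioo (t₀ - δ₁) (t₀ + δ₁) := by
      have := abs_lt.1 ht1
      constructor <;> linarith
    have h1 := hch t ht2 s hs
    have h2 : (γ t - γ s) / c = ((ε * σ : ℝ) : ℂ) * Complex.I := by
      rw [hte]
      simp only [hf]
      push_cast
      field_simp
      ring
    rw [h2] at h1
    have h3 := (Complex.abs_re_le_norm _).trans h1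
    have h4 : |t - s| = 0 := by
      have h5 : |t - s| ≤ 1 / 4 * |t - s| := by simpa [abs_sub_comm] using h3
      have := abs_nonneg (t - s)
      linarith
    have h5 := (Complex.abs_im_le_norm _).trans h1
    rw [h4] at h5
    simp [hσn] at h5
    exact hε.1.ne' h5
  have hBconn : IsPreconnected (f '' B) := by
    refine ((convex_Ioo _ _).prod (convex_Ioo _ _)).isPreconnected.image f ?_
    refine ContinuousOn.add (ContinuousOn.comp (t := Ioo 0 1) ?_ continuousOn_fst ?_) (by fun_prop)
    · exact fun t ht => (hγ.differentiableAt t ht).continuousAt.continuousWithinAt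
    · exact fun p hp => hsub (hδsub hp.1)
  refine ⟨δ, hδ, hδsub.trans hsub, fun F hF => ?_⟩
  have hF' : ∀ z ∈ Metric.ball (γ t₀) (min r η) \ loopTrace γ, ∀ᶠ w in 𝓝 z, F w = F z :=
    fun z hz => hF z ⟨Metric.ball_subset_ball (min_le_left _ _) hz.1, hz.2⟩
  refine ⟨F (f (t₀, ε₀ / 2)), fun t ht => eventually_sideFilter.2 fun κ hκ => ?_⟩
  have hp₀ : (t₀, ε₀ / 2) ∈ B :=
    ⟨⟨by dsimp only; linarith, by dsimp only; linarith⟩,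
      ⟨by dsimp only; linarith, by dsimp only; linarith⟩⟩
  -- A smaller aperture constant means a wider sector: this one contains both the given sector and
  -- the rays of the strip.
  set κ' := min κ (1 / (4 * ‖c‖)) with hκ'
  have hκ'0 : 0 < κ' := lt_min hκ (by positivity)
  have hκ'c : κ' * ‖c‖ ≤ 1 / 4 := by
    have : κ' * ‖c‖ ≤ 1 / (4 * ‖c‖) * ‖c‖ := by
      gcongr
      exact min_le_right _ _
    refine this.trans (le_of_eq ?_)
    field_simp
  have ht01 := hsub (hδsub ht)
  obtain ⟨ρ, hρ, hdisj⟩ := hγ.exists_truncated_sector hσ ht01 hκ'0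
  set ρ' := min ρ (min r η / 2) with hρ'
  have hρ'0 : 0 < ρ' := lt_min hρ (by positivity)
  -- The truncated sector is convex, avoids the loop and meets the strip, so `F` has the value of
  -- the strip on it.
  set T := sideSector γ σ t κ' ∩ Metric.ball (γ t) ρ' with hT
  have hTconn : IsPreconnected T :=
    ((convex_sideSector hκ'0.le).inter (convex_ball _ _)).isPreconnected
  have hTsub : T ⊆ Metric.ball (γ t₀) (min r η) \ loopTrace γ := by
    rintro w ⟨hw, hwρ⟩
    refine ⟨?_, Set.disjoint_left.1 hdisj
      ⟨hw, Metric.ball_subset_ball (min_le_left _ _) hwρ⟩⟩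
    have h1 := Metric.ball_subset_ball (min_le_right ρ (min r η / 2)) hwρ
    have h2 := hnear t ht
    rw [Metric.mem_ball] at *
    calc _ ≤ _ := dist_triangle w (γ t) (γ t₀)
      _ < _ := by linarith
  have hev : ∀ᶠ ε : ℝ in 𝓝[>] 0, f (t, ε) ∈ T ∧ ε ∈ Ioo 0 ε₀ := by
    have h1 := tendsto_ray hσ hc (hder t (hδsub ht)) hκ'c
    have h2 := h1.eventually (inter_mem self_mem_nhdsWithin
      (nhdsWithin_le_nhds (Metric.ball_mem_nhds _ hρ'0)))
    exact h2.and (Ioo_mem_nhdsGT hε₀)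
  obtain ⟨ε, hεT, hε⟩ := hev.exists
  have hval : F (f (t, ε)) = F (f (t₀, ε₀ / 2)) :=
    hBconn.exists_eq_of_eventually_eq
      (by rintro _ ⟨p, hp, rfl⟩; exact hF' _ ⟨hfball p hp, hfavoid p hp⟩)
      ⟨(t, ε), ⟨ht, hε⟩, rfl⟩ ⟨_, hp₀, rfl⟩
  have hle : 𝓝[sideSector γ σ t κ] (γ t) ≤ 𝓝[sideSector γ σ t κ'] (γ t) :=
    nhdsWithin_mono _ (sideSector_anti (min_le_left _ _))
  refine hle ?_
  filter_upwards [inter_mem self_mem_nhdsWithin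
    (nhdsWithin_le_nhds (Metric.ball_mem_nhds _ hρ'0))] with w hw
  rw [← hval]
  exact hTconn.exists_eq_of_eventually_eq (fun z hz => hF' z (hTsub hz)) hw hεT

/-! ### Local solutions of linear differential equations. -/

/-- Local solvability of the linear equation `Φ' = A Φ`, `Φ(z₀) = 1`, with invertible values. -/
theorem exists_local_fundamental_solution {𝔸 : Type*} [NormedRing 𝔸] [NormedAlgebra ℂ 𝔸]
    [CompleteSpace 𝔸] {A : ℂ → 𝔸} {z₀ : ℂ} {R : ℝ} (hR : 0 < R)
    (hA : DifferentiableOn ℂ A (Metric.ball z₀ R)) :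
    ∃ r > 0, r ≤ R ∧ ∃ Φ : ℂ → 𝔸, ∀ z ∈ Metric.ball z₀ r,
      HasDerivAt Φ (A z * Φ z) z ∧ IsUnit (Φ z) := by
  have hcont : ContinuousAt A z₀ :=
    hA.continuousOn.continuousAt (Metric.ball_mem_nhds _ hR)
  obtain ⟨r₁, hr₁, hb⟩ := Metric.continuousAt_iff.1 hcont 1 one_pos
  set M := ‖A z₀‖ + 1 with hM
  have hM0 : 0 < M := by positivity
  -- On this ball `M * r ≤ 1 / 2`, so each Picard step halves the bound.
  set r := min (min R r₁) (1 / (2 * M)) with hr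
  have hr0 : 0 < r := by positivity
  have hrR : r ≤ R := (min_le_left _ _).trans (min_le_left _ _)
  have hrM : M * r ≤ 1 / 2 := by
    have : M * r ≤ M * (1 / (2 * M)) := by gcongr; exact min_le_right _ _
    refine this.trans (le_of_eq ?_)
    field_simp
  have hz₀ : z₀ ∈ Metric.ball z₀ r := Metric.mem_ball_self hr0
  have hAr : DifferentiableOn ℂ A (Metric.ball z₀ r) := hA.mono (Metric.ball_subset_ball hrR)
  have hAM : ∀ z ∈ Metric.ball z₀ r, ‖A z‖ ≤ M := by
    intro z hz
    have h1 := hb (x := z) (lt_of_lt_of_le hz ((min_le_left _ _).trans (min_le_right _ _)))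
    rw [dist_eq_norm] at h1
    have := norm_add_le (A z - A z₀) (A z₀)
    rw [sub_add_cancel] at this
    linarith
  -- A choice of primitives vanishing at `z₀`, made total by the default `0` on non-holomorphic
  -- functions, so that it can be iterated.
  have hprim : ∀ f : ℂ → 𝔸, ∃ g : ℂ → 𝔸, DifferentiableOn ℂ f (Metric.ball z₀ r) →
      g z₀ = 0 ∧ ∀ z ∈ Metric.ball z₀ r, HasDerivAt g (f z) z := by
    intro f
    by_cases hf : DifferentiableOn ℂ f (Metric.ball z₀ r)
    · obtain ⟨g, hg⟩ := hf.isExactOn_ball.with_val_at z₀ 0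
      exact ⟨g, fun _ => hg⟩
    · exact ⟨0, fun h => absurd h hf⟩
  choose T hT using hprim
  -- Terms of the Picard series: `Φ 0 = 1` and `Φ (k + 1)` is the primitive of `A Φ k`. Their sum is
  -- the solution.
  set Φ : ℕ → ℂ → 𝔸 := fun k => (fun f => T (fun z => A z * f z))^[k] 1 with hΦ
  have hsucc : ∀ k, Φ (k + 1) = T (fun z => A z * Φ k z) := fun k => by
    simp only [hΦ, Function.iterate_succ_apply']
  have hdiff : ∀ k, DifferentiableOn ℂ (Φ k) (Metric.ball z₀ r) := by
    intro k
    induction k with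
    | zero => exact differentiableOn_const (c := (1 : 𝔸))
    | succ k ih =>
      rw [hsucc]
      exact fun z hz => ((hT _ (hAr.mul ih)).2 z hz).differentiableAt.differentiableWithinAt
  have hstep : ∀ k, Φ (k + 1) z₀ = 0 ∧
      ∀ z ∈ Metric.ball z₀ r, HasDerivAt (Φ (k + 1)) (A z * Φ k z) z := by
    intro k
    rw [hsucc]
    exact hT _ (hAr.mul (hdiff k))
  have hbound : ∀ k, ∀ z ∈ Metric.ball z₀ r, ‖Φ k z‖ ≤ (1 / 2) ^ k * ‖(1 : 𝔸)‖ := by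
    intro k
    induction k with
    | zero => intro z _; simp [hΦ]
    | succ k ih =>
      intro z hz
      have h1 : ∀ x ∈ Metric.ball z₀ r, ‖A x * Φ k x‖ ≤ M * ((1 / 2) ^ k * ‖(1 : 𝔸)‖) :=
        fun x hx => (norm_mul_le _ _).trans (by gcongr; exacts [hAM x hx, ih x hx])
      have h2 := (convex_ball z₀ r).norm_image_sub_le_of_norm_hasDerivWithin_le
        (fun x hx => ((hstep k).2 x hx).hasDerivWithinAt) h1 hz₀ hz
      rw [(hstep k).1, sub_zero] at h2
      refine h2.trans ?_
      have h3 : ‖z - z₀‖ ≤ r := (mem_ball_iff_norm.1 hz).le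
      calc M * ((1 / 2) ^ k * ‖(1 : 𝔸)‖) * ‖z - z₀‖ ≤ M * ((1 / 2) ^ k * ‖(1 : 𝔸)‖) * r := by
            gcongr
        _ = M * r * ((1 / 2) ^ k * ‖(1 : 𝔸)‖) := by ring
        _ ≤ 1 / 2 * ((1 / 2) ^ k * ‖(1 : 𝔸)‖) := by gcongr
        _ = _ := by ring
  have hgeom : Summable fun k : ℕ => (1 / 2 : ℝ) ^ k := summable_geometric_two
  have hsum : ∀ z ∈ Metric.ball z₀ r, Summable fun k => Φ k z := fun z hz =>
    Summable.of_norm_bounded (hgeom.mul_right ‖(1 : 𝔸)‖) fun k => hbound k z hz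
  have hder : ∀ z ∈ Metric.ball z₀ r,
      HasDerivAt (fun w => ∑' k, Φ (k + 1) w) (∑' k, A z * Φ k z) z := by
    intro z hz
    refine hasDerivAt_tsum_of_isPreconnected (hgeom.mul_right (M * ‖(1 : 𝔸)‖)) Metric.isOpen_ball
      (convex_ball z₀ r).isPreconnected (fun k y hy => (hstep k).2 y hy) (fun k y hy => ?_) hz₀
      ((summable_nat_add_iff 1).2 (hsum z₀ hz₀)) hz
    refine (norm_mul_le _ _).trans ?_
    calc _ ≤ M * ((1 / 2) ^ k * ‖(1 : 𝔸)‖) := by gcongr; exacts [hAM y hy, hbound k y hy]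
      _ = _ := by ring
  set S : ℂ → 𝔸 := fun w => ∑' k, Φ k w with hS
  have hSder : ∀ z ∈ Metric.ball z₀ r, HasDerivAt S (A z * S z) z := by
    intro z hz
    have h1 := (hder z hz).const_add (1 : 𝔸)
    rw [(hsum z hz).tsum_mul_left] at h1
    refine h1.congr_of_eventuallyEq ?_
    filter_upwards [Metric.isOpen_ball.mem_nhds hz] with w hw
    rw [hS]
    simp only
    rw [(hsum w hw).tsum_eq_zero_add]
    rfl
  have hS0 : S z₀ = 1 := by
    rw [hS]
    simp only
    rw [(hsum z₀ hz₀).tsum_eq_zero_add, tsum_congr fun k => (hstep k).1, tsum_zero, add_zero]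
    rfl
  -- Units form an open set and `S z₀ = 1`; shrinking the ball gives invertibility.
  have hunit : ∀ᶠ z in 𝓝 z₀, IsUnit (S z) :=
    (hSder z₀ hz₀).continuousAt.eventually
      (Units.isOpen.mem_nhds (by simp [hS0, isUnit_one]))
  obtain ⟨r₂, hr₂, hu⟩ := Metric.eventually_nhds_iff_ball.1 hunit
  exact ⟨min r r₂, lt_min hr0 hr₂, (min_le_left _ _).trans hrR, S, fun z hz =>
    ⟨hSder z (Metric.ball_subset_ball (min_le_left _ _) hz),
      hu z (Metric.ball_subset_ball (min_le_right _ _) hz)⟩⟩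

-- The operator norm only serves to make matrices a Banach algebra; the conclusion is entrywise and
-- independent of it.
attribute [local instance] Matrix.linftyOpNormedRing Matrix.linftyOpNormedAlgebra in
theorem exists_local_matrix_solution {n : Type*} [Fintype n] [DecidableEq n]
    {A : ℂ → Matrix n n ℂ} {z₀ : ℂ} {R : ℝ} (hR : 0 < R)
    (hA : MatrixHolomorphicOn A (Metric.ball z₀ R)) :
    ∃ r > 0, r ≤ R ∧ ∃ Φ : ℂ → Matrix n n ℂ, ∀ z ∈ Metric.ball z₀ r,
      (∀ i j, HasDerivAt (fun w => Φ w i j) ((A z * Φ z) i j) z) ∧ IsUnit (Φ z).det := by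
  have hA' : DifferentiableOn ℂ A (Metric.ball z₀ R) :=
    differentiableOn_pi.2 fun i => differentiableOn_pi.2 fun j => hA i j
  obtain ⟨r, hr, hrR, Φ, h⟩ := exists_local_fundamental_solution hR hA'
  refine ⟨r, hr, hrR, Φ, fun z hz => ⟨fun i j => ?_, (Matrix.isUnit_iff_isUnit_det _).1 (h z hz).2⟩⟩
  exact hasDerivAt_pi.1 (hasDerivAt_pi.1 (h z hz).1 i) j

theorem eventually_eq_of_hasDerivAt_zero {f : ℂ → ℂ} {U : Set ℂ} (hU : IsOpen U)
    (h : ∀ z ∈ U, HasDerivAt f 0 z) {z : ℂ} (hz : z ∈ U) : ∀ᶠ w in 𝓝 z, f w = f z := by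
  obtain ⟨ε, hε, hsub⟩ := Metric.isOpen_iff.1 hU z hz
  filter_upwards [Metric.ball_mem_nhds z hε] with w hw
  have := (convex_ball z ε).norm_image_sub_le_of_norm_hasDerivWithin_le (C := 0)
    (fun x hx => (h x (hsub hx)).hasDerivWithinAt) (fun x _ => by simp)
    (Metric.mem_ball_self hε) hw
  rw [zero_mul] at this
  exact sub_eq_zero.1 (norm_le_zero_iff.1 this)

/-! ### Entrywise calculus of matrix functions and the Pearson equation. -/

section Matrix

variable {l m n : Type*} {S : Set ℂ}

theorem MatrixHolomorphicOn.mul [Fintype m] {A : ℂ → Matrix l m ℂ} {B : ℂ → Matrix m n ℂ}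
    (hA : MatrixHolomorphicOn A S) (hB : MatrixHolomorphicOn B S) :
    MatrixHolomorphicOn (fun z => A z * B z) S := fun i j => by
  simp only [Matrix.mul_apply]
  exact DifferentiableOn.fun_sum fun k _ => (hA i k).mul (hB k j)

theorem MatrixHolomorphicOn.mono {A : ℂ → Matrix m n ℂ} {T : Set ℂ}
    (hA : MatrixHolomorphicOn A S) (h : T ⊆ S) : MatrixHolomorphicOn A T :=
  fun i j => (hA i j).mono h

theorem MatrixHolomorphicOn.continuousOn {A : ℂ → Matrix m n ℂ} (hA : MatrixHolomorphicOn A S) :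
    ContinuousOn A S :=
  continuousOn_pi.2 fun i => continuousOn_pi.2 fun j => (hA i j).continuousOn

theorem MatrixHolomorphicOn.const (A : Matrix m n ℂ) : MatrixHolomorphicOn (fun _ => A) S :=
  fun _ _ => differentiableOn_const _

theorem MatrixHolomorphicOn.neg {A : ℂ → Matrix m n ℂ} (hA : MatrixHolomorphicOn A S) :
    MatrixHolomorphicOn (fun z => -A z) S := fun i j => (hA i j).neg

theorem MatrixHolomorphicOn.transpose {A : ℂ → Matrix m n ℂ} (hA : MatrixHolomorphicOn A S) :
    MatrixHolomorphicOn (fun z => (A z).transpose) S := fun i j => hA j i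

theorem MatrixHolomorphicOn.fromBlocks {o : Type*} {A : ℂ → Matrix m n ℂ} {B : ℂ → Matrix m o ℂ}
    {C : ℂ → Matrix l n ℂ} {D : ℂ → Matrix l o ℂ} (hA : MatrixHolomorphicOn A S)
    (hB : MatrixHolomorphicOn B S) (hC : MatrixHolomorphicOn C S) (hD : MatrixHolomorphicOn D S) :
    MatrixHolomorphicOn (fun z => Matrix.fromBlocks (A z) (B z) (C z) (D z)) S := by
  rintro (i | i) (j | j)
  exacts [hA i j, hB i j, hC i j, hD i j]

theorem Filter.Tendsto.matrix_fromBlocks {α o : Type*} {f : Filter α} {A : α → Matrix m n ℂ}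
    {B : α → Matrix m o ℂ} {C : α → Matrix l n ℂ} {D : α → Matrix l o ℂ} {a : Matrix m n ℂ}
    {b : Matrix m o ℂ} {c : Matrix l n ℂ} {d : Matrix l o ℂ} (hA : Tendsto A f (𝓝 a))
    (hB : Tendsto B f (𝓝 b)) (hC : Tendsto C f (𝓝 c)) (hD : Tendsto D f (𝓝 d)) :
    Tendsto (fun x => Matrix.fromBlocks (A x) (B x) (C x) (D x)) f
      (𝓝 (Matrix.fromBlocks a b c d)) := by
  refine tendsto_pi_nhds.2 fun i => tendsto_pi_nhds.2 fun j => ?_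
  rcases i with i | i <;> rcases j with j | j
  exacts [tendsto_pi_nhds.1 (tendsto_pi_nhds.1 hA i) j,
    tendsto_pi_nhds.1 (tendsto_pi_nhds.1 hB i) j,
    tendsto_pi_nhds.1 (tendsto_pi_nhds.1 hC i) j, tendsto_pi_nhds.1 (tendsto_pi_nhds.1 hD i) j]

theorem Filter.Tendsto.matrix_mul {α : Type*} {f : Filter α} [Fintype m] {A : α → Matrix l m ℂ}
    {B : α → Matrix m n ℂ} {a : Matrix l m ℂ} {b : Matrix m n ℂ} (hA : Tendsto A f (𝓝 a))
    (hB : Tendsto B f (𝓝 b)) : Tendsto (fun x => A x * B x) f (𝓝 (a * b)) := by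
  refine tendsto_pi_nhds.2 fun i => tendsto_pi_nhds.2 fun j => ?_
  simp only [Matrix.mul_apply]
  exact tendsto_finsetSum _ fun k _ => (tendsto_pi_nhds.1 (tendsto_pi_nhds.1 hA i) k).mul
    (tendsto_pi_nhds.1 (tendsto_pi_nhds.1 hB k) j)

variable [Fintype n] [DecidableEq n]

theorem MatrixHolomorphicOn.det {A : ℂ → Matrix n n ℂ} (hA : MatrixHolomorphicOn A S) :
    DifferentiableOn ℂ (fun z => (A z).det) S := by
  simp only [Matrix.det_apply]
  refine DifferentiableOn.fun_sum fun σ _ => DifferentiableOn.const_smul ?_ _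
  exact DifferentiableOn.fun_finsetProd fun i _ => hA _ _

theorem MatrixHolomorphicOn.inv {A : ℂ → Matrix n n ℂ} (hA : MatrixHolomorphicOn A S)
    (hdet : ∀ z ∈ S, IsUnit (A z).det) : MatrixHolomorphicOn (fun z => (A z)⁻¹) S := fun i j => by
  simp only [Matrix.inv_def, Matrix.smul_apply, Ring.inverse_eq_inv', Matrix.adjugate_apply,
    smul_eq_mul]
  refine (hA.det.inv fun z hz => (hdet z hz).ne_zero).mul (MatrixHolomorphicOn.det fun a b => ?_)
  simp only [Matrix.updateRow_apply]
  split_ifs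
  · exact differentiableOn_const _
  · exact hA a b

theorem Filter.Tendsto.matrix_inv {α : Type*} {f : Filter α} {A : α → Matrix n n ℂ}
    {a : Matrix n n ℂ} (hA : Tendsto A f (𝓝 a)) (ha : IsUnit a.det) :
    Tendsto (fun x => (A x)⁻¹) f (𝓝 a⁻¹) := by
  simp only [Matrix.inv_def, Ring.inverse_eq_inv']
  exact ((((continuous_id.matrix_det).tendsto a).comp hA).inv₀ ha.ne_zero).smul
    (((continuous_id.matrix_adjugate).tendsto a).comp hA)

/-- A solution of `z² W' = W h` off a closed set is, near `z₀ ≠ 0`, a locally constant function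
times a holomorphic one. -/
theorem exists_right_transport {T : Set ℂ} (hT : IsOpen Tᶜ) {W h : ℂ → Matrix n n ℂ}
    (hh : MatrixHolomorphicOn h univ) (hW : MatrixHolomorphicOn W Tᶜ)
    (hode : ∀ z ∉ T, ∀ i j, z ^ 2 * deriv (fun w => W w i j) z = (W z * h z) i j)
    {z₀ : ℂ} (hz₀ : z₀ ≠ 0) :
    ∃ r > 0, ∃ Ψ : ℂ → Matrix n n ℂ, MatrixHolomorphicOn Ψ (Metric.ball z₀ r) ∧
      (∀ z ∈ Metric.ball z₀ r, IsUnit (Ψ z).det) ∧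
      ∀ z ∈ Metric.ball z₀ r \ T, ∀ᶠ w in 𝓝 z, W w * Ψ w = W z * Ψ z := by
  have hne : ∀ z ∈ Metric.ball z₀ ‖z₀‖, z ≠ 0 := by
    rintro z hz rfl
    simp at hz
  -- The coefficient of the equation for `Ψ` has the opposite sign, so that the two terms of `(W
  -- Ψ)'` cancel. The radius `‖z₀‖` excludes the singular point `0`.
  have hA : MatrixHolomorphicOn (fun z => -((z ^ 2)⁻¹ • h z)) (Metric.ball z₀ ‖z₀‖) := by
    intro i j
    refine DifferentiableOn.neg (DifferentiableOn.mul ?_ ((hh i j).mono (subset_univ _)))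
    exact DifferentiableOn.inv (by fun_prop) fun z hz => pow_ne_zero _ (hne z hz)
  obtain ⟨r, hr, hrR, Ψ, hΨ⟩ := exists_local_matrix_solution (norm_pos_iff.2 hz₀) hA
  refine ⟨r, hr, Ψ, fun i j z hz => ((hΨ z hz).1 i j).differentiableAt.differentiableWithinAt,
    fun z hz => (hΨ z hz).2, fun z hz => ?_⟩
  have hU : IsOpen (Metric.ball z₀ r \ T) := Metric.isOpen_ball.inter hT
  have hder : ∀ i j, ∀ z ∈ Metric.ball z₀ r \ T, HasDerivAt (fun w => (W w * Ψ w) i j) 0 z := by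
    intro i j z hz
    have hz0 := hne z (Metric.ball_subset_ball hrR hz.1)
    have hWd : ∀ k, HasDerivAt (fun w => W w i k) ((z ^ 2)⁻¹ * (W z * h z) i k) z := by
      intro k
      rw [← hode z hz.2, inv_mul_cancel_left₀ (pow_ne_zero 2 hz0)]
      exact ((hW i k).differentiableAt (hT.mem_nhds hz.2)).hasDerivAt
    have hsum := HasDerivAt.fun_sum (u := Finset.univ)
      fun k _ => (hWd k).mul ((hΨ z hz.1).1 k j)
    have e : ∑ k, ((z ^ 2)⁻¹ * (W z * h z) i k * Ψ z k j +
        W z i k * (-((z ^ 2)⁻¹ • h z) * Ψ z) k j) = 0 := by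
      rw [Finset.sum_add_distrib]
      have e1 : ∑ k, (z ^ 2)⁻¹ * (W z * h z) i k * Ψ z k j =
          (((z ^ 2)⁻¹ • (W z * h z)) * Ψ z) i j := by
        simp [Matrix.mul_apply (M := ((z ^ 2)⁻¹ • (W z * h z)))]
      have e2 : ∑ k, W z i k * (-((z ^ 2)⁻¹ • h z) * Ψ z) k j =
          (W z * (-((z ^ 2)⁻¹ • h z) * Ψ z)) i j := by
        simp [Matrix.mul_apply (M := W z)]
      rw [e1, e2, ← Matrix.add_apply]
      simp [Matrix.mul_assoc]
    rw [e] at hsum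
    exact hsum
  have := fun i j => eventually_eq_of_hasDerivAt_zero hU (hder i j) hz
  filter_upwards [eventually_all.2 fun i => eventually_all.2 fun j => this i j] with w hw
  ext i j
  exact hw i j

end Matrix

/-! ### Boundary values of solutions of the Pearson equations. -/

namespace IsSimpleLoopAtZero

variable {γ : ℝ → ℂ} {n : Type*} [Fintype n] [DecidableEq n]

/-- The product with `Ψ` is constant on each side. The holomorphic factor `G = Ψ⁻¹` is common to
both sides and to all nearby `t`; only the constants `Kp`, `Km` distinguish the sides. -/
theorem exists_right_side_limits (hγ : IsSimpleLoopAtZero γ) {W h : ℂ → Matrix n n ℂ}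
    (hh : MatrixHolomorphicOn h univ) (hW : MatrixHolomorphicOn W (loopTrace γ)ᶜ)
    (hdet : ∀ z ∉ loopTrace γ, IsUnit (W z).det)
    (hode : ∀ z ∉ loopTrace γ, ∀ i j, z ^ 2 * deriv (fun w => W w i j) z = (W z * h z) i j)
    {t₀ : ℝ} (ht₀ : t₀ ∈ Ioo (0 : ℝ) 1) :
    ∃ r > 0, ∃ δ > 0, Ioo (t₀ - δ) (t₀ + δ) ⊆ Ioo 0 1 ∧
      ∃ (G : ℂ → Matrix n n ℂ) (Kp Km : Matrix n n ℂ),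
        MatrixHolomorphicOn G (Metric.ball (γ t₀) r) ∧
        (∀ z ∈ Metric.ball (γ t₀) r, IsUnit (G z).det) ∧ IsUnit Kp.det ∧ IsUnit Km.det ∧
        ∀ t ∈ Ioo (t₀ - δ) (t₀ + δ), γ t ∈ Metric.ball (γ t₀) r ∧
          Tendsto W (sideFilter γ 1 t) (𝓝 (Kp * G (γ t))) ∧
          Tendsto W (sideFilter γ (-1) t) (𝓝 (Km * G (γ t))) := by
  obtain ⟨r, hr, Ψ, hΨ, hΨdet, hloc⟩ :=
    exists_right_transport hγ.isOpen_compl_trace hh hW hode (hγ.ne_zero ht₀)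
  have key : ∀ σ : ℝ, σ = 1 ∨ σ = -1 → ∃ δ > 0, Ioo (t₀ - δ) (t₀ + δ) ⊆ Ioo 0 1 ∧
      ∃ K : Matrix n n ℂ, IsUnit K.det ∧
      ∀ t ∈ Ioo (t₀ - δ) (t₀ + δ), γ t ∈ Metric.ball (γ t₀) r →
        Tendsto W (sideFilter γ σ t) (𝓝 (K * (Ψ (γ t))⁻¹)) := by
    intro σ hσ
    obtain ⟨δ, hδ, hsub, hconst⟩ := hγ.exists_side_const (X := Matrix n n ℂ) hσ ht₀ hr
    obtain ⟨K, hK⟩ := hconst (fun w => W w * Ψ w) hloc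
    refine ⟨δ, hδ, hsub, K, ?_, fun t ht htr => ?_⟩
    · have hne := sideFilter_neBot hσ (hγ.deriv_ne_zero t₀ ht₀)
      -- `K` equals `W w * Ψ w` at some point `w` off the loop, hence is invertible.
      obtain ⟨w, hw1, hw2, hw3⟩ := ((hK t₀ ⟨by linarith, by linarith⟩).and
        ((hγ.eventually_notMem_trace hσ ht₀).and
          (sideFilter_le_nhds γ σ t₀ (Metric.ball_mem_nhds _ hr)))).exists
      rw [← hw1, Matrix.det_mul]
      exact (hdet w hw2).mul (hΨdet w hw3)
    · have hball := sideFilter_le_nhds γ σ t (Metric.isOpen_ball.mem_nhds htr)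
      have hΨlim : Tendsto Ψ (sideFilter γ σ t) (𝓝 (Ψ (γ t))) :=
        (hΨ.continuousOn.continuousAt (Metric.isOpen_ball.mem_nhds htr)).tendsto.mono_left
          (sideFilter_le_nhds γ σ t)
      refine Tendsto.congr' ?_ (tendsto_const_nhds.matrix_mul (hΨlim.matrix_inv (hΨdet _ htr)))
      filter_upwards [hK t ht, hball] with w hw1 hw2
      rw [← hw1, Matrix.mul_nonsing_inv_cancel_right _ _ (hΨdet w hw2)]
  obtain ⟨δ₁, hδ₁, hs₁, Kp, hKp, hlimp⟩ := key 1 (Or.inl rfl)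
  obtain ⟨δ₂, hδ₂, hs₂, Km, hKm, hlimm⟩ := key (-1) (Or.inr rfl)
  have hcont := (hγ.differentiableAt t₀ ht₀).continuousAt
  obtain ⟨δ₃, hδ₃, hb⟩ := Metric.continuousAt_iff.1 hcont r hr
  refine ⟨r, hr, min (min δ₁ δ₂) δ₃, by positivity, ?_, fun z => (Ψ z)⁻¹, Kp, Km, hΨ.inv hΨdet,
    fun z hz => Matrix.isUnit_nonsing_inv_det _ (hΨdet z hz), hKp, hKm, fun t ht => ?_⟩
  · have : min (min δ₁ δ₂) δ₃ ≤ δ₁ := (min_le_left _ _).trans (min_le_left _ _)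
    exact (Ioo_subset_Ioo (by linarith) (by linarith)).trans hs₁
  · have h1 : min (min δ₁ δ₂) δ₃ ≤ δ₁ := (min_le_left _ _).trans (min_le_left _ _)
    have h2 : min (min δ₁ δ₂) δ₃ ≤ δ₂ := (min_le_left _ _).trans (min_le_right _ _)
    have h3 : min (min δ₁ δ₂) δ₃ ≤ δ₃ := min_le_right _ _
    have hmem : γ t ∈ Metric.ball (γ t₀) r := hb (by
      rw [Real.dist_eq, abs_lt]
      constructor <;> linarith [ht.1, ht.2])
    exact ⟨hmem, hlimp t ⟨by linarith [ht.1], by linarith [ht.2]⟩ hmem,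
      hlimm t ⟨by linarith [ht.1], by linarith [ht.2]⟩ hmem⟩

/-- Transposition turns the left equation into the right one. -/
theorem exists_left_side_limits (hγ : IsSimpleLoopAtZero γ) {W h : ℂ → Matrix n n ℂ}
    (hh : MatrixHolomorphicOn h univ) (hW : MatrixHolomorphicOn W (loopTrace γ)ᶜ)
    (hdet : ∀ z ∉ loopTrace γ, IsUnit (W z).det)
    (hode : ∀ z ∉ loopTrace γ, ∀ i j, z ^ 2 * deriv (fun w => W w i j) z = (h z * W z) i j)
    {t₀ : ℝ} (ht₀ : t₀ ∈ Ioo (0 : ℝ) 1) :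
    ∃ r > 0, ∃ δ > 0, Ioo (t₀ - δ) (t₀ + δ) ⊆ Ioo 0 1 ∧
      ∃ (G : ℂ → Matrix n n ℂ) (Kp Km : Matrix n n ℂ),
        MatrixHolomorphicOn G (Metric.ball (γ t₀) r) ∧
        (∀ z ∈ Metric.ball (γ t₀) r, IsUnit (G z).det) ∧ IsUnit Kp.det ∧ IsUnit Km.det ∧
        ∀ t ∈ Ioo (t₀ - δ) (t₀ + δ), γ t ∈ Metric.ball (γ t₀) r ∧
          Tendsto W (sideFilter γ 1 t) (𝓝 (G (γ t) * Kp)) ∧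
          Tendsto W (sideFilter γ (-1) t) (𝓝 (G (γ t) * Km)) := by
  obtain ⟨r, hr, δ, hδ, hsub, G, Kp, Km, hG, hGdet, hKp, hKm, hlim⟩ :=
    hγ.exists_right_side_limits hh.transpose hW.transpose
      (fun z hz => by rw [Matrix.det_transpose]; exact hdet z hz)
      (fun z hz i j => by
        rw [← Matrix.transpose_mul]
        exact hode z hz j i) ht₀
  have htr : ∀ {f : Filter ℂ} {A : Matrix n n ℂ}, Tendsto (fun z => (W z).transpose) f (𝓝 A) →
      Tendsto W f (𝓝 A.transpose) := fun {f A} hA => by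
    simpa [Function.comp_def] using (continuous_id.matrix_transpose.tendsto A).comp hA
  refine ⟨r, hr, δ, hδ, hsub, fun z => (G z).transpose, Kp.transpose, Km.transpose, hG.transpose,
    fun z hz => by rw [Matrix.det_transpose]; exact hGdet z hz,
    by rwa [Matrix.det_transpose], by rwa [Matrix.det_transpose], fun t ht => ?_⟩
  obtain ⟨h1, h2, h3⟩ := hlim t ht
  refine ⟨h1, ?_, ?_⟩
  · rw [← Matrix.transpose_mul]
    exact htr h2
  · rw [← Matrix.transpose_mul]
    exact htr h3

end IsSimpleLoopAtZero

/-! ### Cauchy integrals and the Plemelj formula. -/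

/-- Differentiation under the integral sign; the kernel is bounded near `z`. A general interval is
allowed because the arcs away from `γ t₀` contribute functions differentiable at `γ t₀` itself. -/
theorem hasDerivAt_cauchyIntegral {γ h : ℝ → ℂ} {a b : ℝ} (hab : a ≤ b)
    (hγ : ContinuousOn γ (Icc a b)) (hh : IntervalIntegrable h volume a b) {z : ℂ}
    (hz : z ∉ γ '' Icc a b) :
    HasDerivAt (fun w => ∫ t in a..b, (γ t - w)⁻¹ * h t)
      (∫ t in a..b, ((γ t - z) ^ 2)⁻¹ * h t) z := by
  have hK : IsOpen (γ '' Icc a b)ᶜ := (isCompact_Icc.image_of_continuousOn hγ).isClosed.isOpen_compl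
  obtain ⟨ε, hε, hsub⟩ := Metric.isOpen_iff.1 hK z hz
  have hne : ∀ x ∈ Metric.ball z ε, ∀ t ∈ Icc a b, γ t - x ≠ 0 := fun x hx t ht h0 =>
    hsub hx ⟨t, ht, sub_eq_zero.1 h0⟩
  have hint : ∀ x ∈ Metric.ball z ε, ∀ k : ℕ,
      IntervalIntegrable (fun t => ((γ t - x) ^ k)⁻¹ * h t) volume a b := by
    intro x hx k
    refine hh.continuousOn_mul ?_
    rw [uIcc_of_le hab]
    exact ((hγ.sub continuousOn_const).pow k).inv₀ fun t ht => pow_ne_zero _ (hne x hx t ht)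
  have hfar : ∀ x ∈ Metric.ball z (ε / 2), ∀ t ∈ Icc a b, ε / 2 ≤ ‖γ t - x‖ := by
    intro x hx t ht
    by_contra hc
    push Not at hc
    rw [Metric.mem_ball] at hx
    rw [← dist_eq_norm] at hc
    have hmem : γ t ∈ Metric.ball z ε := by
      rw [Metric.mem_ball]
      linarith [dist_triangle (γ t) x z]
    exact hsub hmem ⟨t, ht, rfl⟩
  have hzε := Metric.mem_ball_self (x := z) hε
  have hioc : ∀ t ∈ uIoc a b, t ∈ Icc a b := fun t ht => by
    rw [uIoc_of_le hab] at ht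
    exact ⟨ht.1.le, ht.2⟩
  refine (intervalIntegral.hasDerivAt_integral_of_dominated_loc_of_deriv_le
    (bound := fun t => ((ε / 2) ^ 2)⁻¹ * ‖h t‖) (F' := fun x t => ((γ t - x) ^ 2)⁻¹ * h t)
    (Metric.ball_mem_nhds z (half_pos hε)) ?_ ?_ ?_ ?_ (hh.norm.const_mul _) ?_).2
  · filter_upwards [Metric.ball_mem_nhds z hε] with x hx
    simpa using (intervalIntegrable_iff.1 (hint x hx 1)).aestronglyMeasurable
  · simpa using hint z hzε 1
  · exact (intervalIntegrable_iff.1 (hint z hzε 2)).aestronglyMeasurable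
  · refine Eventually.of_forall fun t ht x hx => ?_
    rw [norm_mul, norm_inv, norm_pow]
    gcongr
    exact hfar x hx t (hioc t ht)
  · refine Eventually.of_forall fun t ht x hx => ?_
    have hx' := Metric.ball_subset_ball (half_le_self hε.le) hx
    have := (((hasDerivAt_id x).const_sub (γ t)).inv (hne x hx' t (hioc t ht))).mul_const (h t)
    simpa using this

/-- The difference quotients are bounded by a bound for `g'` and converge except at `t₀`, so
dominated convergence applies. The limit is over a full neighbourhood and is therefore the same from
both sides. -/
theorem tendsto_integral_dslope {γ : ℝ → ℂ} {a b t₀ : ℝ} (hab : a ≤ b)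
    (hγ : ContinuousOn γ (Icc a b)) (hγ' : ContinuousOn (deriv γ) (Icc a b)) {g : ℂ → ℂ} {z₀ : ℂ}
    {r : ℝ} (hr : 0 < r) (hg : DifferentiableOn ℂ g (Metric.ball z₀ r))
    (hball : ∀ t ∈ Icc a b, γ t ∈ Metric.ball z₀ (r / 2))
    (hinj : ∀ t ∈ Icc a b, γ t = z₀ → t = t₀) :
    ∃ l, Tendsto (fun z => ∫ t in a..b, (g (γ t) - g z) / (γ t - z) * deriv γ t) (𝓝 z₀) (𝓝 l) := by
  have hioc : ∀ t ∈ uIoc a b, t ∈ Icc a b := fun t ht => by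
    rw [uIoc_of_le hab] at ht
    exact ⟨ht.1.le, ht.2⟩
  have hcd : ContinuousOn (deriv g) (Metric.closedBall z₀ (r / 2)) :=
    ((hg.deriv Metric.isOpen_ball).continuousOn).mono
      (Metric.closedBall_subset_ball (by linarith))
  obtain ⟨M, hM⟩ := (isCompact_closedBall z₀ (r / 2)).exists_bound_of_continuousOn hcd
  have hsub2 : Metric.ball z₀ (r / 2) ⊆ Metric.ball z₀ r := Metric.ball_subset_ball (by linarith)
  have hlip : ∀ z ∈ Metric.ball z₀ (r / 2), ∀ w ∈ Metric.ball z₀ (r / 2),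
      ‖g w - g z‖ ≤ M * ‖w - z‖ := fun z hz w hw =>
    (convex_ball z₀ (r / 2)).norm_image_sub_le_of_norm_deriv_le
      (fun x hx => (hg.differentiableAt (Metric.isOpen_ball.mem_nhds (hsub2 hx))))
      (fun x hx => hM x (Metric.ball_subset_closedBall hx)) hz hw
  have hM0 : 0 ≤ M := (norm_nonneg _).trans (hM z₀ (Metric.mem_closedBall_self (by linarith)))
  have hev : ∀ᶠ z in 𝓝 z₀, z ∈ Metric.ball z₀ (r / 2) := Metric.ball_mem_nhds _ (by linarith)
  have hrestr : (volume.restrict (uIoc a b)) ≤ volume.restrict (Icc a b) :=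
    Measure.restrict_mono hioc le_rfl
  have hγm : AEMeasurable γ (volume.restrict (uIoc a b)) :=
    (hγ.aemeasurable measurableSet_Icc).mono_measure hrestr
  have hγ'm : AEMeasurable (deriv γ) (volume.restrict (uIoc a b)) :=
    (hγ'.aemeasurable measurableSet_Icc).mono_measure hrestr
  have hgm : AEMeasurable (fun t => g (γ t)) (volume.restrict (uIoc a b)) :=
    ((hg.continuousOn.comp hγ fun t ht => hsub2 (hball t ht)).aemeasurable
      measurableSet_Icc).mono_measure hrestr
  refine ⟨_, intervalIntegral.tendsto_integral_filter_of_dominated_convergence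
    (f := fun t => (g (γ t) - g z₀) / (γ t - z₀) * deriv γ t)
    (fun t => M * ‖deriv γ t‖) ?_ ?_ ?_ ?_⟩
  · exact Eventually.of_forall fun z =>
      (((hgm.sub_const _).div (hγm.sub_const _)).mul hγ'm).aestronglyMeasurable
  · filter_upwards [hev] with z hz
    refine Eventually.of_forall fun t ht => ?_
    rw [norm_mul, norm_div]
    gcongr
    -- This also covers `γ t = z`, where the quotient is `0` by convention.
    exact div_le_of_le_mul₀ (norm_nonneg _) hM0 (hlip z hz _ (hball t (hioc t ht)))
  · refine (ContinuousOn.intervalIntegrable ?_).norm.const_mul M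
    rwa [uIcc_of_le hab]
  · filter_upwards [compl_mem_ae_iff.2 (measure_singleton t₀)] with t ht ht'
    have hne : γ t - z₀ ≠ 0 := fun h => ht (hinj t (hioc t ht') (sub_eq_zero.1 h))
    have hgc : ContinuousAt g z₀ :=
      hg.continuousOn.continuousAt (Metric.ball_mem_nhds _ hr)
    exact ((tendsto_const_nhds.sub hgc.tendsto).div (tendsto_const_nhds.sub tendsto_id)
      hne).mul_const _

theorem log_sub_log_neg_of_im_pos {x : ℂ} (hx : 0 < x.im) :
    Complex.log x - Complex.log (-x) = Real.pi * Complex.I := by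
  rw [Complex.log, Complex.log, norm_neg, Complex.arg_neg_eq_arg_sub_pi_of_im_pos hx]
  push_cast
  ring

theorem log_sub_log_neg_of_im_neg {x : ℂ} (hx : x.im < 0) :
    Complex.log x - Complex.log (-x) = -(Real.pi * Complex.I) := by
  rw [Complex.log, Complex.log, norm_neg, Complex.arg_neg_eq_arg_add_pi_of_im_neg hx]
  push_cast
  ring

namespace IsSimpleLoopAtZero

variable {γ : ℝ → ℂ}

/-- Boundary values of the Cauchy integral of the constant density `1` over a short arc. -/
theorem tendsto_arc_cauchyIntegral (hγ : IsSimpleLoopAtZero γ) {t₀ δ : ℝ}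
    (ht₀ : t₀ ∈ Ioo (0 : ℝ) 1) (hsub : Ioo (t₀ - δ) (t₀ + δ) ⊆ Ioo 0 1)
    (hch : ∀ s ∈ Ioo (t₀ - δ) (t₀ + δ), ∀ t ∈ Ioo (t₀ - δ) (t₀ + δ),
        ‖(γ s - γ t) / deriv γ t₀ - ((s - t : ℝ) : ℂ)‖ ≤ 1 / 4 * |s - t|)
    {a b : ℝ} (ha : a ∈ Ioo (t₀ - δ) t₀) (hb : b ∈ Ioo t₀ (t₀ + δ)) {σ : ℝ}
    (hσ : σ = 1 ∨ σ = -1) :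
    Tendsto (fun z => ∫ t in a..b, (γ t - z)⁻¹ * deriv γ t) (sideFilter γ σ t₀)
      (𝓝 (Complex.log (Complex.I * σ * ((γ b - γ t₀) / deriv γ t₀)) -
        Complex.log (Complex.I * σ * ((γ a - γ t₀) / deriv γ t₀)))) := by
  have hab : a ≤ b := ha.2.le.trans hb.1.le
  have hIcc : Icc a b ⊆ Ioo (t₀ - δ) (t₀ + δ) := fun t ht =>
    ⟨ha.1.trans_le ht.1, ht.2.trans_lt hb.2⟩
  have ht₀' : t₀ ∈ Ioo (t₀ - δ) (t₀ + δ) := ⟨ha.1.trans ha.2, hb.1.trans hb.2⟩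
  have hIcc01 : Icc a b ⊆ Icc 0 1 := fun t ht => Ioo_subset_Icc_self (hsub (hIcc ht))
  have hc := hγ.deriv_ne_zero t₀ ht₀
  set c := deriv γ t₀ with hcdef
  have hσ2 := sq_eq_one_of_sign hσ
  have hσ0 : (σ : ℂ) ≠ 0 := by
    rcases hσ with rfl | rfl <;> norm_num
  have hcontγ : ContinuousOn γ (Icc a b) := hγ.continuousOn.mono hIcc01
  have hcontγ' : ContinuousOn (deriv γ) (Icc a b) :=
    hγ.continuousOn_deriv.mono fun t ht => hsub (hIcc ht)
  have hγint : IntervalIntegrable (deriv γ) volume a b :=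
    ContinuousOn.intervalIntegrable (by rwa [uIcc_of_le hab])
  have htr : γ '' Icc a b ⊆ loopTrace γ := image_mono hIcc01
  -- The rotation by `i σ / c` places the cut of the logarithm so that, for `z` on the normal ray of
  -- side `σ`, the arc avoids it.
  set L : ℂ → ℂ → ℂ := fun p z => Complex.log (Complex.I * σ * ((p - z) / c)) with hL
  have hre : ∀ t ∈ Icc a b, t ≠ t₀ → ((γ t - γ t₀) / c).re ≠ 0 := by
    intro t ht hne h0
    have h1 := (Complex.abs_re_le_norm _).trans (hch t (hIcc ht) t₀ ht₀')
    rw [Complex.sub_re, h0, Complex.ofReal_re, zero_sub, abs_neg] at h1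
    have : 0 < |t - t₀| := abs_pos.2 (sub_ne_zero.2 hne)
    linarith
  have hslit : ∀ t ∈ Icc a b, t ≠ t₀ →
      Complex.I * σ * ((γ t - γ t₀) / c) ∈ Complex.slitPlane := by
    intro t ht hne
    refine Or.inr ?_
    rw [mul_assoc, Complex.I_mul_im, Complex.re_ofReal_mul]
    exact mul_ne_zero (by exact_mod_cast hσ0) (hre t ht hne)
  have hlogder : ∀ p z : ℂ, Complex.I * σ * ((p - z) / c) ∈ Complex.slitPlane →
      HasDerivAt (L p) (-(p - z)⁻¹) z := by
    intro p z hp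
    have h1 : HasDerivAt (fun z => Complex.I * σ * ((p - z) / c)) (Complex.I * σ * (-1 / c)) z :=
      (((hasDerivAt_id z).const_sub p).div_const c).const_mul _
    convert h1.clog hp using 1
    have hpz : p - z ≠ 0 := by
      rintro h0
      rw [h0] at hp
      simp at hp
    field_simp [Complex.I_ne_zero]
  have ha' : a ∈ Icc a b := ⟨le_rfl, hab⟩
  have hb' : b ∈ Icc a b := ⟨hab, le_rfl⟩
  have hevslit : ∀ t ∈ Icc a b, t ≠ t₀ →
      ∀ᶠ z in 𝓝 (γ t₀), Complex.I * σ * ((γ t - z) / c) ∈ Complex.slitPlane := by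
    intro t ht hne
    have : Continuous fun z => Complex.I * σ * ((γ t - z) / c) := by fun_prop
    exact this.continuousAt.eventually (Complex.isOpen_slitPlane.mem_nhds (hslit t ht hne))
  obtain ⟨r, hr, hball⟩ := Metric.eventually_nhds_iff_ball.1
    ((hevslit b hb' hb.1.ne').and (hevslit a ha' ha.2.ne))
  set E : ℂ → ℂ := fun z => ∫ t in a..b, (γ t - z)⁻¹ * deriv γ t with hE
  -- `F` has zero derivative off the loop near `γ t₀`, hence is constant on the side `σ`; it
  -- vanishes on the normal ray, so the constant is `0`.
  set F : ℂ → ℂ := fun z => E z - (L (γ b) z - L (γ a) z) with hF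
  have hFder : ∀ z ∈ Metric.ball (γ t₀) r \ loopTrace γ, HasDerivAt F 0 z := by
    intro z hz
    have h1 := hasDerivAt_cauchyIntegral hab hcontγ hγint (fun h => hz.2 (htr h))
    have hne : ∀ t ∈ Icc a b, γ t - z ≠ 0 := fun t ht h =>
      hz.2 (htr ⟨t, ht, sub_eq_zero.1 h⟩)
    have h2 : ∫ t in a..b, ((γ t - z) ^ 2)⁻¹ * deriv γ t = -(γ b - z)⁻¹ - -(γ a - z)⁻¹ := by
      refine intervalIntegral.integral_eq_sub_of_hasDerivAt (f := fun t => -(γ t - z)⁻¹) ?_ ?_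
      · intro t ht
        rw [uIcc_of_le hab] at ht
        have := (((hγ.differentiableAt t (hsub (hIcc ht))).hasDerivAt.sub_const z).inv
          (hne t ht)).neg
        exact this.congr_deriv (by rw [neg_div, neg_neg, div_eq_inv_mul])
      · refine hγint.continuousOn_mul ?_
        rw [uIcc_of_le hab]
        exact ((hcontγ.sub continuousOn_const).pow 2).inv₀ fun t ht => pow_ne_zero _ (hne t ht)
    rw [h2] at h1
    have h3 := h1.sub ((hlogder _ z (hball z hz.1).1).sub (hlogder _ z (hball z hz.1).2))
    rwa [sub_self] at h3
  obtain ⟨δ', hδ', -, hconst⟩ := hγ.exists_side_const (X := ℂ) hσ ht₀ hr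
  obtain ⟨k, hk⟩ := hconst F fun z hz =>
    eventually_eq_of_hasDerivAt_zero (Metric.isOpen_ball.inter hγ.isOpen_compl_trace) hFder hz
  have hk₀ := hk t₀ ⟨by linarith, by linarith⟩
  have hray := tendsto_normal_ray hσ hc
  have hzero : ∀ ε : ℝ, 0 < ε → F (γ t₀ + ε * (σ * Complex.I * c)) = 0 := by
    intro ε hε
    set z := γ t₀ + ε * (σ * Complex.I * c) with hz
    have hval : ∀ t, Complex.I * σ * ((γ t - z) / c) =
        Complex.I * σ * ((γ t - γ t₀) / c) + ε := by
      intro t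
      have hσc : (σ : ℂ) * σ = 1 := by exact_mod_cast hσ2
      have hI := Complex.I_mul_I
      rw [hz]
      field_simp
      linear_combination (-(ε : ℂ) * c * σ * σ) * hI + (ε : ℂ) * c * hσc
    -- At `t₀` the rotated point is `ε > 0`; at every other `t` its imaginary part is nonzero. So
    -- the logarithm is a primitive along the entire arc.
    have hmem : ∀ t ∈ Icc a b, Complex.I * σ * ((γ t - z) / c) ∈ Complex.slitPlane := by
      intro t ht
      rw [hval]
      by_cases hne : t = t₀
      · rw [hne]
        refine Or.inl ?_
        simpa using hε
      · refine Or.inr ?_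
        rw [Complex.add_im, Complex.ofReal_im, add_zero, mul_assoc, Complex.I_mul_im,
          Complex.re_ofReal_mul]
        exact mul_ne_zero (by exact_mod_cast hσ0) (hre t ht hne)
    have hne : ∀ t ∈ Icc a b, γ t - z ≠ 0 := by
      intro t ht h0
      have := hmem t ht
      rw [h0] at this
      simp at this
    have : E z = L (γ b) z - L (γ a) z := by
      refine intervalIntegral.integral_eq_sub_of_hasDerivAt (f := fun t => L (γ t) z) ?_ ?_
      · intro t ht
        rw [uIcc_of_le hab] at ht
        have h1 := (((hγ.differentiableAt t (hsub (hIcc ht))).hasDerivAt.sub_const z).div_const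
          c).const_mul (Complex.I * σ)
        have := hne t ht
        exact (h1.clog_real (hmem t ht)).congr_deriv (by field_simp [Complex.I_ne_zero])
      · refine hγint.continuousOn_mul ?_
        rw [uIcc_of_le hab]
        exact (hcontγ.sub continuousOn_const).inv₀ hne
    rw [hF]
    simp only
    rw [this, sub_self]
  have hk0 : k = 0 := by
    obtain ⟨ε, h1, h2⟩ := ((hray.eventually hk₀).and self_mem_nhdsWithin).exists
    rw [← h1, hzero ε h2]
  have hlim : Tendsto (fun z => L (γ b) z - L (γ a) z) (𝓝 (γ t₀))
      (𝓝 (L (γ b) (γ t₀) - L (γ a) (γ t₀))) :=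
    ((hlogder _ _ (hslit b hb' hb.1.ne')).continuousAt.sub
      (hlogder _ _ (hslit a ha' ha.2.ne)).continuousAt).tendsto
  refine (hlim.mono_left (sideFilter_le_nhds γ σ t₀)).congr' ?_
  filter_upwards [hk₀] with z hz
  rw [hk0] at hz
  exact (sub_eq_zero.1 hz).symm

/-- The Sokhotski–Plemelj jump formula, for a density which is locally the restriction of a
holomorphic function. -/
theorem cauchyIntegral_jump (hγ : IsSimpleLoopAtZero γ) {t₀ δ r : ℝ} (ht₀ : t₀ ∈ Ioo (0 : ℝ) 1)
    {f : ℝ → ℂ} {g : ℂ → ℂ} (hf : IntervalIntegrable (fun t => f t * deriv γ t) volume 0 1)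
    (hr : 0 < r) (hδ : 0 < δ) (hg : DifferentiableOn ℂ g (Metric.ball (γ t₀) r))
    (hfg : ∀ t ∈ Ioo (t₀ - δ) (t₀ + δ), f t = g (γ t)) :
    ∃ A B : ℂ,
      Tendsto (fun z => ∫ t in (0 : ℝ)..1, (γ t - z)⁻¹ * (f t * deriv γ t)) (sideFilter γ 1 t₀)
        (𝓝 A) ∧
      Tendsto (fun z => ∫ t in (0 : ℝ)..1, (γ t - z)⁻¹ * (f t * deriv γ t)) (sideFilter γ (-1) t₀)
        (𝓝 B) ∧ A - B = 2 * Real.pi * Complex.I * f t₀ := by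
  obtain ⟨δ₁, hδ₁, hsub, -, hch⟩ := hγ.exists_chord_estimate ht₀
  obtain ⟨δ₂, hδ₂, hnear⟩ := Metric.continuousAt_iff.1
    (hγ.differentiableAt t₀ ht₀).continuousAt (r / 2) (half_pos hr)
  -- Halving keeps the closed arc `[a, b]` inside all three open neighbourhoods.
  set d := min δ (min δ₁ δ₂) / 2 with hd
  have hmin : 0 < min δ (min δ₁ δ₂) := by positivity
  have hd0 : 0 < d := half_pos hmin
  have hdδ : d < δ := (half_lt_self hmin).trans_le (min_le_left _ _)
  have hdδ₁ : d < δ₁ := (half_lt_self hmin).trans_le ((min_le_right _ _).trans (min_le_left _ _))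
  have hdδ₂ : d < δ₂ := (half_lt_self hmin).trans_le ((min_le_right _ _).trans (min_le_right _ _))
  set a := t₀ - d with ha
  set b := t₀ + d with hb
  have haI : a ∈ Ioo (t₀ - δ₁) t₀ := ⟨by linarith, by linarith⟩
  have hbI : b ∈ Ioo t₀ (t₀ + δ₁) := ⟨by linarith, by linarith⟩
  have hab : a ≤ b := by linarith
  have ha0 : 0 < a := (hsub ⟨haI.1, by linarith⟩).1
  have hb1 : b < 1 := (hsub ⟨by linarith, hbI.2⟩).2
  have hIcc : Icc a b ⊆ Ioo 0 1 := fun t ht => ⟨ha0.trans_le ht.1, ht.2.trans_lt hb1⟩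
  have hcontγ : ContinuousOn γ (Icc a b) :=
    hγ.continuousOn.mono (hIcc.trans Ioo_subset_Icc_self)
  have hcontγ' : ContinuousOn (deriv γ) (Icc a b) := hγ.continuousOn_deriv.mono hIcc
  have hballt : ∀ t ∈ Icc a b, γ t ∈ Metric.ball (γ t₀) (r / 2) := fun t ht => hnear (by
    rw [Real.dist_eq, abs_lt]
    constructor <;> linarith [ht.1, ht.2])
  have hinj : ∀ t ∈ Icc (0 : ℝ) 1, γ t = γ t₀ → t = t₀ := fun t ht h => hγ.eq_of_eq ht₀ ht h
  obtain ⟨l, hl⟩ := tendsto_integral_dslope hab hcontγ hcontγ' hr hg hballt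
    (fun t ht => hinj t (Ioo_subset_Icc_self (hIcc ht)))
  have hf1 : IntervalIntegrable (fun t => f t * deriv γ t) volume 0 a :=
    hf.mono_set (by
      rw [uIcc_of_le ha0.le, uIcc_of_le zero_le_one]
      exact Icc_subset_Icc le_rfl (by linarith))
  have hf2 : IntervalIntegrable (fun t => f t * deriv γ t) volume a b :=
    hf.mono_set (by
      rw [uIcc_of_le hab, uIcc_of_le zero_le_one]
      exact Icc_subset_Icc ha0.le hb1.le)
  have hf3 : IntervalIntegrable (fun t => f t * deriv γ t) volume b 1 :=
    hf.mono_set (by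
      rw [uIcc_of_le hb1.le, uIcc_of_le zero_le_one]
      exact Icc_subset_Icc (by linarith) le_rfl)
  have hc1 := (hasDerivAt_cauchyIntegral (z := γ t₀) ha0.le
    (hγ.continuousOn.mono (Icc_subset_Icc le_rfl (by linarith))) hf1 (by
      rintro ⟨t, ht, h⟩
      have := hinj t ⟨ht.1, by linarith [ht.2]⟩ h
      linarith [ht.2])).continuousAt.tendsto
  have hc3 := (hasDerivAt_cauchyIntegral (z := γ t₀) hb1.le
    (hγ.continuousOn.mono (Icc_subset_Icc (by linarith) le_rfl)) hf3 (by
      rintro ⟨t, ht, h⟩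
      have := hinj t ⟨by linarith [ht.1], ht.2⟩ h
      linarith [ht.1])).continuousAt.tendsto
  have hgc : Tendsto g (𝓝 (γ t₀)) (𝓝 (g (γ t₀))) :=
    (hg.continuousOn.continuousAt (Metric.ball_mem_nhds _ hr)).tendsto
  have hdecomp : ∀ z ∉ loopTrace γ, ∫ t in (0 : ℝ)..1, (γ t - z)⁻¹ * (f t * deriv γ t) =
      (∫ t in (0 : ℝ)..a, (γ t - z)⁻¹ * (f t * deriv γ t)) +
      ((∫ t in a..b, (g (γ t) - g z) / (γ t - z) * deriv γ t) +
        g z * ∫ t in a..b, (γ t - z)⁻¹ * deriv γ t) +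
      ∫ t in b..1, (γ t - z)⁻¹ * (f t * deriv γ t) := by
    intro z hz
    have hne : ∀ t ∈ Icc (0 : ℝ) 1, γ t - z ≠ 0 := fun t ht h =>
      hz ⟨t, ht, sub_eq_zero.1 h⟩
    have hinv : ContinuousOn (fun t => (γ t - z)⁻¹) (Icc 0 1) :=
      (hγ.continuousOn.sub continuousOn_const).inv₀ hne
    have hI : ∀ {p q : ℝ}, p ≤ q → 0 ≤ p → q ≤ 1 → ∀ {h : ℝ → ℂ}, IntervalIntegrable h volume p q →
        IntervalIntegrable (fun t => (γ t - z)⁻¹ * h t) volume p q := by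
      intro p q hpq hp hq h hh
      refine hh.continuousOn_mul (hinv.mono ?_)
      rw [uIcc_of_le hpq]
      exact Icc_subset_Icc hp hq
    rw [← intervalIntegral.integral_add_adjacent_intervals (hI (by linarith) le_rfl hb1.le
        (hf1.trans hf2)) (hI hb1.le (by linarith) le_rfl hf3),
      ← intervalIntegral.integral_add_adjacent_intervals (hI ha0.le le_rfl (by linarith) hf1)
        (hI hab ha0.le hb1.le hf2)]
    congr 2
    rw [← intervalIntegral.integral_const_mul, ← intervalIntegral.integral_add]
    · refine intervalIntegral.integral_congr fun t ht => ?_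
      rw [uIcc_of_le hab] at ht
      rw [hfg t ⟨by linarith [ht.1], by linarith [ht.2]⟩]
      have := hne t (Ioo_subset_Icc_self (hIcc ht))
      field_simp
      ring
    · refine ContinuousOn.intervalIntegrable ?_
      rw [uIcc_of_le hab]
      refine ContinuousOn.mul (ContinuousOn.div ?_ (hcontγ.sub continuousOn_const)
        fun t ht => hne t (Ioo_subset_Icc_self (hIcc ht))) hcontγ'
      exact (hg.continuousOn.comp hcontγ fun t ht =>
        Metric.ball_subset_ball (by linarith) (hballt t ht)).sub continuousOn_const
    · refine (hI hab ha0.le hb1.le (ContinuousOn.intervalIntegrable ?_)).const_mul _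
      rwa [uIcc_of_le hab]
  have hside : ∀ σ : ℝ, σ = 1 ∨ σ = -1 → Tendsto
      (fun z => ∫ t in (0 : ℝ)..1, (γ t - z)⁻¹ * (f t * deriv γ t)) (sideFilter γ σ t₀) _ :=
    fun σ hσ =>
    ((((hc1.mono_left (sideFilter_le_nhds γ σ t₀)).add
      ((hl.mono_left (sideFilter_le_nhds γ σ t₀)).add
        ((hgc.mono_left (sideFilter_le_nhds γ σ t₀)).mul
          (hγ.tendsto_arc_cauchyIntegral ht₀ hsub hch haI hbI hσ)))).add
      (hc3.mono_left (sideFilter_le_nhds γ σ t₀))).congr'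
      ((hγ.eventually_notMem_trace hσ ht₀).mono fun z hz => (hdecomp z hz).symm))
  refine ⟨_, _, hside 1 (Or.inl rfl), hside (-1) (Or.inr rfl), ?_⟩
  have hre : ∀ t ∈ Ioo (t₀ - δ₁) (t₀ + δ₁),
      |((γ t - γ t₀) / deriv γ t₀).re - (t - t₀)| ≤ 1 / 4 * |t - t₀| := fun t ht => by
    have := (Complex.abs_re_le_norm _).trans (hch t ht t₀ ⟨by linarith, by linarith⟩)
    rwa [Complex.sub_re, Complex.ofReal_re] at this
  -- The logarithms for the two sides have opposite arguments. The chord to `b` has positive real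
  -- part and the chord to `a` negative, so the endpoints give `πi` and `-πi`, whose difference is
  -- `2πi`.
  have h1 := log_sub_log_neg_of_im_pos (x := Complex.I * ((γ b - γ t₀) / deriv γ t₀)) (by
    have h := abs_le.1 (hre b ⟨by linarith, hbI.2⟩)
    rw [abs_of_pos (by linarith : 0 < b - t₀)] at h
    rw [Complex.I_mul_im]
    linarith [h.1])
  have h2 := log_sub_log_neg_of_im_neg (x := Complex.I * ((γ a - γ t₀) / deriv γ t₀)) (by
    have h := abs_le.1 (hre a ⟨haI.1, by linarith⟩)
    rw [abs_of_neg (by linarith : a - t₀ < 0)] at h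
    rw [Complex.I_mul_im]
    linarith [h.2])
  rw [hfg t₀ ⟨by linarith, by linarith⟩]
  simp only [Complex.ofReal_one, Complex.ofReal_neg, mul_one, mul_neg, neg_mul]
  linear_combination (g (γ t₀)) * h1 - (g (γ t₀)) * h2

end IsSimpleLoopAtZero

/-! ### Matrix Cauchy transforms and integrability of the densities. -/

section CauchyTransform

variable {m n : Type*} {γ : ℝ → ℂ} {V : ℂ → Matrix m n ℂ}

theorem loopIntegral_cauchy_apply (z : ℂ) (i : m) (j : n) :
    loopIntegral γ (fun w => (w - z)⁻¹ • V w) i j = (2 * (Real.pi : ℂ) * Complex.I)⁻¹ *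
      ∫ t in (0 : ℝ)..1, (γ t - z)⁻¹ * (V (γ t) i j * deriv γ t) := by
  simp only [loopIntegral, Matrix.of_apply, Matrix.smul_apply, smul_eq_mul, mul_assoc]

theorem IsSimpleLoopAtZero.holomorphic_cauchyTransform (hγ : IsSimpleLoopAtZero γ)
    (hV : ∀ i j, IntervalIntegrable (fun t => V (γ t) i j * deriv γ t) volume 0 1) :
    MatrixHolomorphicOn (fun z => loopIntegral γ fun w => (w - z)⁻¹ • V w) (loopTrace γ)ᶜ := by
  intro i j z hz
  simp only [loopIntegral_cauchy_apply]
  exact ((hasDerivAt_cauchyIntegral zero_le_one hγ.continuousOn (hV i j)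
    hz).differentiableAt.const_mul _).differentiableWithinAt

theorem IsSimpleLoopAtZero.cauchyTransform_jump (hγ : IsSimpleLoopAtZero γ)
    (hV : ∀ i j, IntervalIntegrable (fun t => V (γ t) i j * deriv γ t) volume 0 1)
    {t₀ δ r : ℝ} (ht₀ : t₀ ∈ Ioo (0 : ℝ) 1) (hr : 0 < r) (hδ : 0 < δ) {G : ℂ → Matrix m n ℂ}
    (hG : MatrixHolomorphicOn G (Metric.ball (γ t₀) r))
    (hVG : ∀ t ∈ Ioo (t₀ - δ) (t₀ + δ), V (γ t) = G (γ t)) :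
    ∃ A B : Matrix m n ℂ,
      Tendsto (fun z => loopIntegral γ fun w => (w - z)⁻¹ • V w) (sideFilter γ 1 t₀) (𝓝 A) ∧
      Tendsto (fun z => loopIntegral γ fun w => (w - z)⁻¹ • V w) (sideFilter γ (-1) t₀) (𝓝 B) ∧
      A = B + V (γ t₀) := by
  choose A B hA hB hAB using fun i j => hγ.cauchyIntegral_jump ht₀ (f := fun t => V (γ t) i j)
    (hV i j) hr hδ (hG i j) (fun t ht => by rw [hVG t ht])
  refine ⟨Matrix.of fun i j => (2 * (Real.pi : ℂ) * Complex.I)⁻¹ * A i j,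
    Matrix.of fun i j => (2 * (Real.pi : ℂ) * Complex.I)⁻¹ * B i j, ?_, ?_, ?_⟩
  · refine tendsto_pi_nhds.2 fun i => tendsto_pi_nhds.2 fun j => ?_
    simp only [loopIntegral_cauchy_apply]
    exact (hA i j).const_mul _
  · refine tendsto_pi_nhds.2 fun i => tendsto_pi_nhds.2 fun j => ?_
    simp only [loopIntegral_cauchy_apply]
    exact (hB i j).const_mul _
  · ext i j
    simp only [Matrix.of_apply, Matrix.add_apply]
    have h := hAB i j
    have h0 := Complex.two_pi_I_ne_zero
    rw [← sub_eq_iff_eq_add', ← mul_sub, h, inv_mul_cancel_left₀ h0]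

end CauchyTransform

section Weight

variable {N : ℕ} {γ : ℝ → ℂ} {W P : ℂ → Matrix (Fin N) (Fin N) ℂ}

theorem IsMonicMatrixPoly.holomorphic {k : ℕ} (hP : IsMonicMatrixPoly k P) :
    MatrixHolomorphicOn P univ := by
  obtain ⟨c, hc⟩ := hP
  intro i j
  simp only [hc, Matrix.add_apply, Matrix.sum_apply, Matrix.smul_apply, smul_eq_mul]
  fun_prop

theorem continuousOn_entry (hγ : IsSimpleLoopAtZero γ) (hP : MatrixHolomorphicOn P univ)
    (i j : Fin N) : ContinuousOn (fun t => P (γ t) i j) (uIcc (0 : ℝ) 1) := by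
  rw [uIcc_of_le zero_le_one]
  exact (hP i j).continuousOn.comp hγ.continuousOn (fun _ _ => mem_univ _)

theorem intervalIntegrable_mul_weight (hγ : IsSimpleLoopAtZero γ)
    (hW : ∀ i j, IntervalIntegrable (fun t => W (γ t) i j * deriv γ t) volume 0 1)
    (hP : MatrixHolomorphicOn P univ) (i j : Fin N) :
    IntervalIntegrable (fun t => (P (γ t) * W (γ t)) i j * deriv γ t) volume 0 1 := by
  simp only [Matrix.mul_apply, Finset.sum_mul, mul_assoc]
  rw [← Finset.sum_fn]
  exact IntervalIntegrable.sum _ fun k _ =>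
    (hW k j).continuousOn_mul (continuousOn_entry hγ hP i k)

theorem intervalIntegrable_weight_mul (hγ : IsSimpleLoopAtZero γ)
    (hW : ∀ i j, IntervalIntegrable (fun t => W (γ t) i j * deriv γ t) volume 0 1)
    (hP : MatrixHolomorphicOn P univ) (i j : Fin N) :
    IntervalIntegrable (fun t => (W (γ t) * P (γ t)) i j * deriv γ t) volume 0 1 := by
  simp only [Matrix.mul_apply, Finset.sum_mul]
  rw [← Finset.sum_fn]
  refine IntervalIntegrable.sum _ fun k _ => ?_
  have := (hW i k).mul_continuousOn (continuousOn_entry hγ hP k j)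
  simpa only [mul_assoc, mul_comm, mul_left_comm] using this

end Weight

/-! ### Block algebra of the jump. -/

section Blocks

variable {n : Type*} [Fintype n] [DecidableEq n]

/-- `L * CL` and `CR * R` are the values from the right. Since `P (L R) R⁻¹ = P L`, the additive
jump of the second column is a copy of the first column, which yields the repeated `CL⁻¹`. -/
theorem left_block_jump {P₁ P₂ Q₁ Q₂ L R CL CR : Matrix n n ℂ} (hR : IsUnit R.det)
    (hCL : IsUnit CL.det) (hCR : IsUnit CR.det) :
    Matrix.fromBlocks P₁ (Q₁ + P₁ * (L * R)) P₂ (Q₂ + P₂ * (L * R)) *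
        Matrix.fromBlocks L 0 0 R⁻¹ =
      Matrix.fromBlocks P₁ Q₁ P₂ Q₂ * Matrix.fromBlocks (L * CL) 0 0 (CR * R)⁻¹ *
        Matrix.fromBlocks CL⁻¹ CL⁻¹ 0 CR := by
  have h : ∀ P Q : Matrix n n ℂ, (Q + P * (L * R)) * R⁻¹ =
      P * (L * CL) * CL⁻¹ + Q * (CR * R)⁻¹ * CR := fun P Q => by
    rw [Matrix.mul_inv_rev, ← Matrix.mul_assoc Q, Matrix.nonsing_inv_mul_cancel_right _ _ hCR,
      ← Matrix.mul_assoc P L CL, Matrix.mul_nonsing_inv_cancel_right _ _ hCL, Matrix.add_mul,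
      ← Matrix.mul_assoc P L R, Matrix.mul_nonsing_inv_cancel_right _ _ hR, add_comm]
  have h' : ∀ P : Matrix n n ℂ, P * (L * CL) * CL⁻¹ = P * L := fun P => by
    rw [← Matrix.mul_assoc, Matrix.mul_nonsing_inv_cancel_right _ _ hCL]
  simp only [Matrix.fromBlocks_multiply, Matrix.mul_zero, add_zero, zero_add, h, h']

theorem right_block_jump {P₁ P₂ Q₁ Q₂ L R CL CR : Matrix n n ℂ} (hL : IsUnit L.det)
    (hCL : IsUnit CL.det) (hCR : IsUnit CR.det) :
    Matrix.fromBlocks R 0 0 L⁻¹ *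
        Matrix.fromBlocks P₁ P₂ (Q₁ + L * R * P₁) (Q₂ + L * R * P₂) =
      Matrix.fromBlocks CR⁻¹ 0 CR⁻¹ CL *
        (Matrix.fromBlocks (CR * R) 0 0 (L * CL)⁻¹ * Matrix.fromBlocks P₁ P₂ Q₁ Q₂) := by
  have h : ∀ P Q : Matrix n n ℂ, L⁻¹ * (Q + L * R * P) =
      CR⁻¹ * (CR * R * P) + CL * ((L * CL)⁻¹ * Q) := fun P Q => by
    rw [Matrix.mul_inv_rev, Matrix.mul_assoc CL⁻¹, Matrix.mul_nonsing_inv_cancel_left _ _ hCL,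
      Matrix.mul_assoc CR, Matrix.nonsing_inv_mul_cancel_left _ _ hCR, Matrix.mul_add,
      Matrix.mul_assoc L, Matrix.nonsing_inv_mul_cancel_left _ _ hL, add_comm]
  have h' : ∀ P : Matrix n n ℂ, CR⁻¹ * (CR * R * P) = R * P := fun P => by
    rw [Matrix.mul_assoc, Matrix.nonsing_inv_mul_cancel_left _ _ hCR]
  simp only [Matrix.fromBlocks_multiply, Matrix.zero_mul, add_zero, zero_add, h, h']

end Blocks

/-! ### Constancy of the jump along the loop and boundary values of the blocks. -/

/-- The functions `W_L` and `W_R` have boundary values at `γ t` related by `C^L` and `C^R`. -/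
def HasConstantJump {N : ℕ} (γ : ℝ → ℂ) (WL WR : ℂ → Matrix (Fin N) (Fin N) ℂ) (t : ℝ)
    (C : Matrix (Fin N) (Fin N) ℂ × Matrix (Fin N) (Fin N) ℂ) : Prop :=
  IsUnit C.1.det ∧ IsUnit C.2.det ∧ ∃ Lp Rp : Matrix (Fin N) (Fin N) ℂ,
    IsUnit Lp.det ∧ IsUnit Rp.det ∧
    Tendsto WL (sideFilter γ 1 t) (𝓝 Lp) ∧ Tendsto WL (sideFilter γ (-1) t) (𝓝 (Lp * C.1)) ∧
    Tendsto WR (sideFilter γ 1 t) (𝓝 Rp) ∧ Tendsto WR (sideFilter γ (-1) t) (𝓝 (C.2 * Rp))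

section Pearson

variable {N : ℕ} {γ : ℝ → ℂ} {W WL WR hL hR : ℂ → Matrix (Fin N) (Fin N) ℂ}

/-- Limits are unique and the values from the left can be cancelled. This allows local constants to
be glued. -/
theorem HasConstantJump.unique (hγ : IsSimpleLoopAtZero γ) {t : ℝ} (ht : t ∈ Ioo (0 : ℝ) 1)
    {C C' : Matrix (Fin N) (Fin N) ℂ × Matrix (Fin N) (Fin N) ℂ}
    (h : HasConstantJump γ WL WR t C) (h' : HasConstantJump γ WL WR t C') : C = C' := by
  obtain ⟨-, -, L, R, hLu, hRu, h1, h2, h3, h4⟩ := h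
  obtain ⟨-, -, L', R', -, -, h1', h2', h3', h4'⟩ := h'
  have := sideFilter_neBot (σ := 1) (Or.inl rfl) (hγ.deriv_ne_zero t ht)
  have := sideFilter_neBot (σ := -1) (Or.inr rfl) (hγ.deriv_ne_zero t ht)
  obtain rfl := tendsto_nhds_unique h1 h1'
  obtain rfl := tendsto_nhds_unique h3 h3'
  have e1 := tendsto_nhds_unique h2 h2'
  have e2 := tendsto_nhds_unique h4 h4'
  refine Prod.ext ?_ ?_
  · rw [← Matrix.nonsing_inv_mul_cancel_left L C.1 hLu, e1,
      Matrix.nonsing_inv_mul_cancel_left L C'.1 hLu]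
  · rw [← Matrix.mul_nonsing_inv_cancel_right R C.2 hRu, e2,
      Matrix.mul_nonsing_inv_cancel_right R C'.2 hRu]

/-- With one-sided values `G₁ Kp`, `G₁ Km` of `W_L` and `Kp' G₂`, `Km' G₂` of `W_R`, the holomorphic
factors cancel from the jumps, while the product of the values from the left extends `W`
holomorphically off the arc. -/
theorem IsPearsonFactorization.exists_local_jump (hγ : IsSimpleLoopAtZero γ)
    (hfac : IsPearsonFactorization γ W WL WR hL hR) {t₀ : ℝ} (ht₀ : t₀ ∈ Ioo (0 : ℝ) 1) :
    ∃ r > 0, ∃ δ > 0, Ioo (t₀ - δ) (t₀ + δ) ⊆ Ioo 0 1 ∧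
      ∃ (C : Matrix (Fin N) (Fin N) ℂ × Matrix (Fin N) (Fin N) ℂ)
        (G : ℂ → Matrix (Fin N) (Fin N) ℂ), MatrixHolomorphicOn G (Metric.ball (γ t₀) r) ∧
        ∀ t ∈ Ioo (t₀ - δ) (t₀ + δ), HasConstantJump γ WL WR t C ∧ W (γ t) = G (γ t) := by
  obtain ⟨r₁, hr₁, δ₁, hδ₁, hs₁, G₁, Kp, Km, hG₁, hG₁u, hKp, hKm, hl₁⟩ :=
    hγ.exists_left_side_limits hfac.entire_left hfac.holomorphic_left hfac.invertible_left
      hfac.pearson_left ht₀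
  obtain ⟨r₂, hr₂, δ₂, hδ₂, hs₂, G₂, Kp', Km', hG₂, hG₂u, hKp', hKm', hl₂⟩ :=
    hγ.exists_right_side_limits hfac.entire_right hfac.holomorphic_right hfac.invertible_right
      hfac.pearson_right ht₀
  have e1 := min_le_left δ₁ δ₂
  have e2 := min_le_right δ₁ δ₂
  have hsub : Ioo (t₀ - min δ₁ δ₂) (t₀ + min δ₁ δ₂) ⊆ Ioo 0 1 :=
    (Ioo_subset_Ioo (by linarith) (by linarith)).trans hs₁
  refine ⟨min r₁ r₂, lt_min hr₁ hr₂, min δ₁ δ₂, lt_min hδ₁ hδ₂, hsub, (Kp⁻¹ * Km, Km' * Kp'⁻¹),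
    fun z => G₁ z * (Kp * Kp') * G₂ z, ?_, fun t ht => ?_⟩
  · exact ((hG₁.mono (Metric.ball_subset_ball (min_le_left _ _))).mul (.const _)).mul
      (hG₂.mono (Metric.ball_subset_ball (min_le_right _ _)))
  · obtain ⟨hb₁, hp₁, hm₁⟩ := hl₁ t ⟨by linarith [ht.1], by linarith [ht.2]⟩
    obtain ⟨hb₂, hp₂, hm₂⟩ := hl₂ t ⟨by linarith [ht.1], by linarith [ht.2]⟩
    refine ⟨⟨?_, ?_, _, _, ?_, ?_, hp₁, ?_, hp₂, ?_⟩, ?_⟩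
    · rw [Matrix.det_mul]
      exact (Matrix.isUnit_nonsing_inv_det _ hKp).mul hKm
    · rw [Matrix.det_mul]
      exact hKm'.mul (Matrix.isUnit_nonsing_inv_det _ hKp')
    · rw [Matrix.det_mul]
      exact (hG₁u _ hb₁).mul hKp
    · rw [Matrix.det_mul]
      exact hKp'.mul (hG₂u _ hb₂)
    · rwa [Matrix.mul_assoc, Matrix.mul_nonsing_inv_cancel_left _ _ hKp]
    · rwa [← Matrix.mul_assoc, Matrix.nonsing_inv_mul_cancel_right _ _ hKp']
    · have := sideFilter_neBot (σ := 1) (Or.inl rfl) (hγ.deriv_ne_zero t (hsub ht))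
      rw [tendsto_nhds_unique (hasPlusValue_iff.1 (hfac.factor t (hsub ht)))
        (hp₁.matrix_mul hp₂)]
      simp only [Matrix.mul_assoc]

theorem IsPearsonFactorization.exists_constant_jump (hγ : IsSimpleLoopAtZero γ)
    (hfac : IsPearsonFactorization γ W WL WR hL hR) :
    ∃ C, ∀ t ∈ Ioo (0 : ℝ) 1, HasConstantJump γ WL WR t C := by
  have hex : ∀ t : ℝ, ∃ C, t ∈ Ioo (0 : ℝ) 1 → HasConstantJump γ WL WR t C := by
    intro t
    by_cases ht : t ∈ Ioo (0 : ℝ) 1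
    · obtain ⟨r, hr, δ, hδ, -, C, G, -, h⟩ := hfac.exists_local_jump hγ ht
      exact ⟨C, fun _ => (h t ⟨by linarith, by linarith⟩).1⟩
    · exact ⟨0, fun h => absurd h ht⟩
  choose C hC using hex
  have hmid : (1 / 2 : ℝ) ∈ Ioo (0 : ℝ) 1 := by norm_num
  refine ⟨C (1 / 2), fun t ht => ?_⟩
  -- By uniqueness the chosen constants are locally constant in `t`, and `(0, 1)` is connected.
  have hconst : C t = C (1 / 2) := by
    refine (convex_Ioo (0 : ℝ) 1).isPreconnected.exists_eq_of_eventually_eq (fun s hs => ?_) ht hmid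
    obtain ⟨r, hr, δ, hδ, hsub, C', G, -, h⟩ := hfac.exists_local_jump hγ hs
    have hall : ∀ u ∈ Ioo (s - δ) (s + δ), C u = C' := fun u hu =>
      (hC u (hsub hu)).unique hγ (hsub hu) (h u hu).1
    filter_upwards [Ioo_mem_nhds (by linarith : s - δ < s) (by linarith : s < s + δ)] with u hu
    rw [hall u hu, hall s ⟨by linarith, by linarith⟩]
  rw [← hconst]
  exact hC t ht

theorem IsPearsonFactorization.secondKind_jump (hγ : IsSimpleLoopAtZero γ)
    (hfac : IsPearsonFactorization γ W WL WR hL hR)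
    (hW : ∀ i j, IntervalIntegrable (fun t => W (γ t) i j * deriv γ t) volume 0 1)
    {P : ℂ → Matrix (Fin N) (Fin N) ℂ} (hP : MatrixHolomorphicOn P univ) {t : ℝ}
    (ht : t ∈ Ioo (0 : ℝ) 1) :
    (∃ Q : Matrix (Fin N) (Fin N) ℂ,
      Tendsto (secondKindL γ W P) (sideFilter γ 1 t) (𝓝 (Q + P (γ t) * W (γ t))) ∧
      Tendsto (secondKindL γ W P) (sideFilter γ (-1) t) (𝓝 Q)) ∧
    ∃ Q : Matrix (Fin N) (Fin N) ℂ,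
      Tendsto (secondKindR γ W P) (sideFilter γ 1 t) (𝓝 (Q + W (γ t) * P (γ t))) ∧
      Tendsto (secondKindR γ W P) (sideFilter γ (-1) t) (𝓝 Q) := by
  obtain ⟨r, hr, δ, hδ, hsub, C, G, hG, h⟩ := hfac.exists_local_jump hγ ht
  have hP' := hP.mono (subset_univ (Metric.ball (γ t) r))
  constructor
  · obtain ⟨A, B, hA, hB, rfl⟩ := hγ.cauchyTransform_jump (V := fun w => P w * W w)
      (intervalIntegrable_mul_weight hγ hW hP) ht hr hδ (hP'.mul hG)
      fun s hs => by simp only [(h s hs).2]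
    exact ⟨B, hA, hB⟩
  · obtain ⟨A, B, hA, hB, rfl⟩ := hγ.cauchyTransform_jump (V := fun w => W w * P w)
      (intervalIntegrable_weight_mul hγ hW hP) ht hr hδ (hG.mul hP')
      fun s hs => by simp only [(h s hs).2]
    exact ⟨B, hA, hB⟩

theorem IsPearsonFactorization.weight_eq (hγ : IsSimpleLoopAtZero γ)
    (hfac : IsPearsonFactorization γ W WL WR hL hR) {t : ℝ} (ht : t ∈ Ioo (0 : ℝ) 1)
    {L R : Matrix (Fin N) (Fin N) ℂ} (h1 : Tendsto WL (sideFilter γ 1 t) (𝓝 L))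
    (h2 : Tendsto WR (sideFilter γ 1 t) (𝓝 R)) : W (γ t) = L * R := by
  have := sideFilter_neBot (σ := 1) (Or.inl rfl) (hγ.deriv_ne_zero t ht)
  exact tendsto_nhds_unique (hasPlusValue_iff.1 (hfac.factor t ht)) (h1.matrix_mul h2)

theorem MatrixHolomorphicOn.tendsto_sideFilter {P : ℂ → Matrix (Fin N) (Fin N) ℂ}
    (hP : MatrixHolomorphicOn P univ) (σ t : ℝ) :
    Tendsto P (sideFilter γ σ t) (𝓝 (P (γ t))) :=
  (hP.continuousOn.continuousAt univ_mem).tendsto.mono_left (sideFilter_le_nhds γ σ t)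

variable {C : Matrix (Fin N) (Fin N) ℂ × Matrix (Fin N) (Fin N) ℂ} {t : ℝ}
  {P₁ P₂ Q₁ Q₂ : ℂ → Matrix (Fin N) (Fin N) ℂ}

/-- Stated for arbitrary blocks, so that the exceptional second row at `n = 0` and the generic one
are treated alike. -/
theorem HasConstantJump.left_blocks (hC : HasConstantJump γ WL WR t C)
    (hWt : ∀ {L R : Matrix (Fin N) (Fin N) ℂ}, Tendsto WL (sideFilter γ 1 t) (𝓝 L) →
      Tendsto WR (sideFilter γ 1 t) (𝓝 R) → W (γ t) = L * R)
    (hP₁ : MatrixHolomorphicOn P₁ univ) (hP₂ : MatrixHolomorphicOn P₂ univ)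
    (hQ₁ : ∃ Q, Tendsto Q₁ (sideFilter γ 1 t) (𝓝 (Q + P₁ (γ t) * W (γ t))) ∧
      Tendsto Q₁ (sideFilter γ (-1) t) (𝓝 Q))
    (hQ₂ : ∃ Q, Tendsto Q₂ (sideFilter γ 1 t) (𝓝 (Q + P₂ (γ t) * W (γ t))) ∧
      Tendsto Q₂ (sideFilter γ (-1) t) (𝓝 Q)) :
    ∃ Zp Zm : Matrix (Fin N ⊕ Fin N) (Fin N ⊕ Fin N) ℂ,
      HasPlusValue γ (fun z => Matrix.fromBlocks (P₁ z) (Q₁ z) (P₂ z) (Q₂ z) *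
        Matrix.fromBlocks (WL z) 0 0 (WR z)⁻¹) t Zp ∧
      HasMinusValue γ (fun z => Matrix.fromBlocks (P₁ z) (Q₁ z) (P₂ z) (Q₂ z) *
        Matrix.fromBlocks (WL z) 0 0 (WR z)⁻¹) t Zm ∧
      Zp = Zm * Matrix.fromBlocks C.1⁻¹ C.1⁻¹ 0 C.2 := by
  obtain ⟨hC1, hC2, L, R, hL, hR, hLp, hLm, hRp, hRm⟩ := hC
  obtain ⟨q₁, hq₁, hq₁'⟩ := hQ₁
  obtain ⟨q₂, hq₂, hq₂'⟩ := hQ₂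
  rw [hWt hLp hRp] at hq₁ hq₂
  have hRm' : IsUnit (C.2 * R).det := by
    rw [Matrix.det_mul]
    exact hC2.mul hR
  exact ⟨_, _, hasPlusValue_iff.2 (((hP₁.tendsto_sideFilter 1 t).matrix_fromBlocks hq₁
      (hP₂.tendsto_sideFilter 1 t) hq₂).matrix_mul
      (hLp.matrix_fromBlocks tendsto_const_nhds tendsto_const_nhds (hRp.matrix_inv hR))),
    hasMinusValue_iff.2 (((hP₁.tendsto_sideFilter (-1) t).matrix_fromBlocks hq₁'
      (hP₂.tendsto_sideFilter (-1) t) hq₂').matrix_mul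
      (hLm.matrix_fromBlocks tendsto_const_nhds tendsto_const_nhds (hRm.matrix_inv hRm'))),
    left_block_jump hR hC1 hC2⟩

theorem HasConstantJump.right_blocks (hC : HasConstantJump γ WL WR t C)
    (hWt : ∀ {L R : Matrix (Fin N) (Fin N) ℂ}, Tendsto WL (sideFilter γ 1 t) (𝓝 L) →
      Tendsto WR (sideFilter γ 1 t) (𝓝 R) → W (γ t) = L * R)
    (hP₁ : MatrixHolomorphicOn P₁ univ) (hP₂ : MatrixHolomorphicOn P₂ univ)
    (hQ₁ : ∃ Q, Tendsto Q₁ (sideFilter γ 1 t) (𝓝 (Q + W (γ t) * P₁ (γ t))) ∧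
      Tendsto Q₁ (sideFilter γ (-1) t) (𝓝 Q))
    (hQ₂ : ∃ Q, Tendsto Q₂ (sideFilter γ 1 t) (𝓝 (Q + W (γ t) * P₂ (γ t))) ∧
      Tendsto Q₂ (sideFilter γ (-1) t) (𝓝 Q)) :
    ∃ Zp Zm : Matrix (Fin N ⊕ Fin N) (Fin N ⊕ Fin N) ℂ,
      HasPlusValue γ (fun z => Matrix.fromBlocks (WR z) 0 0 (WL z)⁻¹ *
        Matrix.fromBlocks (P₁ z) (P₂ z) (Q₁ z) (Q₂ z)) t Zp ∧
      HasMinusValue γ (fun z => Matrix.fromBlocks (WR z) 0 0 (WL z)⁻¹ *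
        Matrix.fromBlocks (P₁ z) (P₂ z) (Q₁ z) (Q₂ z)) t Zm ∧
      Zp = Matrix.fromBlocks C.2⁻¹ 0 C.2⁻¹ C.1 * Zm := by
  obtain ⟨hC1, hC2, L, R, hL, hR, hLp, hLm, hRp, hRm⟩ := hC
  obtain ⟨q₁, hq₁, hq₁'⟩ := hQ₁
  obtain ⟨q₂, hq₂, hq₂'⟩ := hQ₂
  rw [hWt hLp hRp] at hq₁ hq₂
  have hLm' : IsUnit (L * C.1).det := by
    rw [Matrix.det_mul]
    exact hL.mul hC1
  exact ⟨_, _, hasPlusValue_iff.2 ((hRp.matrix_fromBlocks tendsto_const_nhds tendsto_const_nhds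
      (hLp.matrix_inv hL)).matrix_mul ((hP₁.tendsto_sideFilter 1 t).matrix_fromBlocks
      (hP₂.tendsto_sideFilter 1 t) hq₁ hq₂)),
    hasMinusValue_iff.2 ((hRm.matrix_fromBlocks tendsto_const_nhds tendsto_const_nhds
      (hLm.matrix_inv hLm')).matrix_mul ((hP₁.tendsto_sideFilter (-1) t).matrix_fromBlocks
      (hP₂.tendsto_sideFilter (-1) t) hq₁' hq₂')),
    right_block_jump hL hC1 hC2⟩

end Pearson

/-! ### Assembly. -/

theorem mainTheorem8 {N : ℕ} (γ : ℝ → ℂ) (hγ : IsSimpleLoopAtZero γ)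
    (W : ℂ → Matrix (Fin N) (Fin N) ℂ) (hW : IsBesselType γ W) (hreg : IsRegularWeight γ W)
    (PL PR : ℕ → ℂ → Matrix (Fin N) (Fin N) ℂ) (C : ℕ → Matrix (Fin N) (Fin N) ℂ)
    (hP : AreOrthogonalPolys γ W PL PR C)
    (WL WR hL hR : ℂ → Matrix (Fin N) (Fin N) ℂ)
    (hfac : IsPearsonFactorization γ W WL WR hL hR) :
    ∃ CL CR : Matrix (Fin N) (Fin N) ℂ, IsUnit CL.det ∧ IsUnit CR.det ∧
      (∀ t ∈ Ioo (0 : ℝ) 1, ∃ Lp Lm Rp Rm : Matrix (Fin N) (Fin N) ℂ,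
        HasPlusValue γ WL t Lp ∧ HasMinusValue γ WL t Lm ∧
        HasPlusValue γ WR t Rp ∧ HasMinusValue γ WR t Rm ∧
        IsUnit Lp.det ∧ IsUnit Rp.det ∧ Lm = Lp * CL ∧ Rm = CR * Rp) ∧
      ∀ n : ℕ,
        MatrixHolomorphicOn (ZL γ W WL WR PL C n) (loopTrace γ)ᶜ ∧
        MatrixHolomorphicOn (ZR γ W WL WR PR C n) (loopTrace γ)ᶜ ∧
        ∀ t ∈ Ioo (0 : ℝ) 1,
          (∃ Zp Zm : Matrix (Fin N ⊕ Fin N) (Fin N ⊕ Fin N) ℂ,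
            HasPlusValue γ (ZL γ W WL WR PL C n) t Zp ∧
            HasMinusValue γ (ZL γ W WL WR PL C n) t Zm ∧
            Zp = Zm * Matrix.fromBlocks CL⁻¹ CL⁻¹ 0 CR) ∧
          (∃ Zp Zm : Matrix (Fin N ⊕ Fin N) (Fin N ⊕ Fin N) ℂ,
            HasPlusValue γ (ZR γ W WL WR PR C n) t Zp ∧
            HasMinusValue γ (ZR γ W WL WR PR C n) t Zm ∧
            Zp = Matrix.fromBlocks CR⁻¹ 0 CR⁻¹ CL * Zm) := by
  have hLR := hfac.exists_constant_jump hγ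
  obtain ⟨J, hJ⟩ := hLR
  have hmid := hJ (1 / 2) (by norm_num)
  have hPL := fun n => (hP.monic_left n).holomorphic
  have hPR := fun n => (hP.monic_right n).holomorphic
  have hQL : ∀ n, MatrixHolomorphicOn (secondKindL γ W (PL n)) (loopTrace γ)ᶜ := fun n =>
    hγ.holomorphic_cauchyTransform (V := fun w => PL n w * W w)
      (intervalIntegrable_mul_weight hγ hreg.1 (hPL n))
  have hQR : ∀ n, MatrixHolomorphicOn (secondKindR γ W (PR n)) (loopTrace γ)ᶜ := fun n =>
    hγ.holomorphic_cauchyTransform (V := fun w => W w * PR n w)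
      (intervalIntegrable_weight_mul hγ hreg.1 (hPR n))
  have hu := subset_univ (loopTrace γ)ᶜ
  refine ⟨J.1, J.2, hmid.1, hmid.2.1, fun t ht => ?_, fun n => ⟨?_, ?_, fun t ht => ⟨?_, ?_⟩⟩⟩
  · obtain ⟨-, -, L, R, hL, hR, hLp, hLm, hRp, hRm⟩ := hJ t ht
    exact ⟨L, _, R, _, hasPlusValue_iff.2 hLp, hasMinusValue_iff.2 hLm, hasPlusValue_iff.2 hRp,
      hasMinusValue_iff.2 hRm, hL, hR, rfl, rfl⟩
  · have hD := hfac.holomorphic_left.fromBlocks (.const 0) (.const 0)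
      (hfac.holomorphic_right.inv hfac.invertible_right)
    refine MatrixHolomorphicOn.mul ?_ hD
    cases n with
    | zero => exact ((hPL 0).mono hu).fromBlocks (hQL 0) (.const 0) (.const 1)
    | succ n =>
      exact ((hPL (n + 1)).mono hu).fromBlocks (hQL (n + 1))
        ((MatrixHolomorphicOn.const (C n)).mul ((hPL n).mono hu)).neg
        ((MatrixHolomorphicOn.const (C n)).mul (hQL n)).neg
  · have hD := hfac.holomorphic_right.fromBlocks (.const 0) (.const 0)
      (hfac.holomorphic_left.inv hfac.invertible_left)
    refine MatrixHolomorphicOn.mul hD ?_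
    cases n with
    | zero => exact ((hPR 0).mono hu).fromBlocks (.const 0) (hQR 0) (.const 1)
    | succ n =>
      exact ((hPR (n + 1)).mono hu).fromBlocks
        (((hPR n).mono hu).mul (MatrixHolomorphicOn.const (C n))).neg (hQR (n + 1))
        ((hQR n).mul (MatrixHolomorphicOn.const (C n))).neg
  · have hs := fun n => (hfac.secondKind_jump hγ hreg.1 (hPL n) ht).1
    cases n with
    | zero =>
      -- The row `[0, I]` fits the pattern with `P₂ = 0`: its required jump `0 * W` vanishes.
      exact (hJ t ht).left_blocks (hfac.weight_eq hγ ht) (hPL 0) (.const 0) (hs 0)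
        ⟨1, by simpa using tendsto_const_nhds, tendsto_const_nhds⟩
    | succ n =>
      -- Left multiplication by `-C n` commutes with the jump relation for the second kind function
      -- of degree `n`.
      refine (hJ t ht).left_blocks (hfac.weight_eq hγ ht) (hPL (n + 1))
        ((MatrixHolomorphicOn.const (C n)).mul (hPL n)).neg (hs (n + 1)) ?_
      obtain ⟨Q, h1, h2⟩ := hs n
      refine ⟨-(C n * Q), ?_, (tendsto_const_nhds.matrix_mul h2).neg⟩
      convert (tendsto_const_nhds (x := C n)).matrix_mul h1 |>.neg using 2
      rw [Matrix.mul_add, neg_add, Matrix.neg_mul, Matrix.mul_assoc]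
  · have hs := fun n => (hfac.secondKind_jump hγ hreg.1 (hPR n) ht).2
    cases n with
    | zero =>
      exact (hJ t ht).right_blocks (hfac.weight_eq hγ ht) (hPR 0) (.const 0) (hs 0)
        ⟨1, by simpa using tendsto_const_nhds, tendsto_const_nhds⟩
    | succ n =>
      refine (hJ t ht).right_blocks (hfac.weight_eq hγ ht) (hPR (n + 1))
        ((hPR n).mul (MatrixHolomorphicOn.const (C n))).neg (hs (n + 1)) ?_
      obtain ⟨Q, h1, h2⟩ := hs n
      refine ⟨-(Q * C n), ?_, (h2.matrix_mul tendsto_const_nhds).neg⟩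
      convert h1.matrix_mul (tendsto_const_nhds (x := C n)) |>.neg using 2
      rw [Matrix.add_mul, neg_add, Matrix.mul_neg, Matrix.mul_assoc]
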